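/- **Setting.** Let $K=2$ and $N\ge 2$. A library $F=(F_1,\dots,F_N)$ consists of $N$ files of $B$ bits each; all $NB$ bits are i.i.d. uniform. The demand vector $\mathbf D=(D_1,D_2)\in[N]^2$ has a fixed distribution giving positive probability to every pair in $[N]^2$. A *scheme with uncoded cache placement* for file size $B$ (all alphabets finite) consists of the following. The cache metadata $(\mathscr M(C_1),\mathscr M(C_2))$ is random with some joint law, with $F$, $\mathbf D$ and the cache metadata independent; $\mathscr M(C_k)$ determines which bits of the library user $k$ copies into its cache; $C_k$ denotes these bits and $Z_k=(\mathscr M(C_k),C_k)$. A trusted server without access to the library chooses the packet metadata $(\mathscr M(P_1),\mathscr M(P_2))$, possibly at random, from $\mathbf D$ and the cache metadata (so that it is conditionally independent of $F$ given these). The metadata $\mathscr M(P_k)$ describes how the packet $P_k$ of user $k$ is composed, i.e. $P_k$ is a function of $\mathscr M(P_k)$ and $F$; user $k$ broadcasts $X_k=(\mathscr M(P_k),P_k)$. With $\mathbf X=(X_1,X_2)$ and entropies in bits, the scheme *works* for cache size $M$, load $R$ and slack $\epsilon\ge 0$ if for $k=1,2$ $$H(Z_k)\le B(M+\epsilon),\qquad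 H(X_k\mid \mathscr M(P_k),Z_k)=0,\qquad H(F_{D_k}\mid \mathbf X,Z_k,D_k)\le B\epsilon,\qquad I(\mathbf D;\mathbf X,Z_k\mid D_k)=0,$$ and $H(X_1)+H(X_2)\le B(R+\epsilon)$. The load $R$ is *achievable* for cache size $M$ if there are $\epsilon_B\ge 0$ with $\epsilon_B\to 0$ as $B\to\infty$ such that for all sufficiently large $B$ some scheme works for $M$, $R$, $\epsilon_B$. Let $R^\star_{\mathrm u}(M)$ be the infimum of the achievable loads. **Theorem.** Let $M=\frac N2+y$ with $y\in[0,\frac N2]$. Then $$R^\star_{\mathrm u}(M)\ \ge\ N-2y-\frac{4y+(N-1)h}{h+2}+\frac{h^2(N-1)-N(N-3)+h(N+1)}{(h+1)(h+2)}\cdot\frac{2y}{N}$$ for every integer $h$ with $0\le h\le N-3$ (no condition if $N=2$), $$R^\star_{\mathrm u}(M)\ \ge\ 2\Bigl(1-\frac{3y}{N}\Bigr),\qquad\text{and}\qquad R^\star_{\mathrm u}(M)\ \ge\ 2\Bigl(\frac12-\frac yN\Bigr).$$ -/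

import Mathlib

open Filter Topology

noncomputable section

namespace D2DCaching

/-! ### Shannon information measures of finitely-valued random variables, in bits -/

section Information

variable {Ω α β γ : Type} [Fintype α] [Fintype β] [Fintype γ]

/-- Shannon entropy `H(X)` (base 2) of the random variable `X` on the probability space `(Ω, P)`. -/
def entropy (P : PMF Ω) (X : Ω → α) : ℝ :=
  (∑ a, Real.negMulLog ((P.map X) a).toReal) / Real.log 2

/-- Conditional entropy `H(X | Y) = H(X, Y) - H(Y)`. -/
def condEntropy (P : PMF Ω) (X : Ω → α) (Y : Ω → β) : ℝ :=
  entropy P (fun ω => (X ω, Y ω)) - entropy P Y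

/-- Conditional mutual information `I(X; Y | Z) = H(X | Z) + H(Y | Z) - H(X, Y | Z)`. -/
def condMutualInfo (P : PMF Ω) (X : Ω → α) (Y : Ω → β) (Z : Ω → γ) : ℝ :=
  condEntropy P X Z + condEntropy P Y Z - condEntropy P (fun ω => (X ω, Y ω)) Z

end Information

/-! ### The `(K, N)` device-to-device caching system with a trusted server -/

/-- A library of `N` files of `B` bits each. -/
abbrev Library (N B : ℕ) : Type := Fin N → Fin B → Bool

/-- A scheme with uncoded cache placement for `K` users, `N` files and `B` bits per file.
All alphabets are finite. -/
structure Scheme (K N B : ℕ) where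
  /-- The possible values of the metadata of the cached content of each user. -/
  CacheMeta : Fin K → Type
  /-- The possible values of the metadata of the packets sent by each user. -/
  PacketMeta : Fin K → Type
  /-- The possible values of the packets sent by each user. -/
  Packet : Fin K → Type
  [fintypeCacheMeta : ∀ k, Fintype (CacheMeta k)]
  [fintypePacketMeta : ∀ k, Fintype (PacketMeta k)]
  [fintypePacket : ∀ k, Fintype (Packet k)]
  /-- The joint law of the cache metadata of all users. It depends neither on the demands nor on
  the content of the library. -/
  placement : PMF ((k : Fin K) → CacheMeta k)
  /-- Uncoded placement: the cache metadata of a user says which bits of the library (bit `b` of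
  file `n` is the pair `(n, b)`) the user copies into its cache. -/
  stored : (k : Fin K) → CacheMeta k → Finset (Fin N × Fin B)
  /-- The trusted server picks the packet metadata of all users, possibly at random, knowing the
  demands and the cache metadata of all users, but not the library. -/
  server : (Fin K → Fin N) → ((k : Fin K) → CacheMeta k) → PMF ((k : Fin K) → PacketMeta k)
  /-- The packet metadata describes how the packet is composed from the bits of the library. -/
  compose : (k : Fin K) → PacketMeta k → Library N B → Packet k

namespace Scheme

attribute [instance] Scheme.fintypeCacheMeta Scheme.fintypePacketMeta Scheme.fintypePacket

variable {K N B : ℕ} (S : Scheme K N B)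

/-- An outcome: demands, cache metadata, packet metadata, library. -/
abbrev Outcome : Type :=
  (Fin K → Fin N) × ((k : Fin K) → S.CacheMeta k) × ((k : Fin K) → S.PacketMeta k) × Library N B

/-- The joint law: the demands, the cache metadata and the library are independent, the bits of the
library are independent and uniform, and the server acts on demands and cache metadata only. -/
def law (demandLaw : PMF (Fin K → Fin N)) : PMF S.Outcome :=
  demandLaw.bind fun d =>
    S.placement.bind fun c =>
      (S.server d c).bind fun p =>
        (PMF.uniformOfFintype (Library N B)).bind fun F =>
          PMF.pure (d, c, p, F)

/-- The demand vector `D`. -/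
def demands (ω : S.Outcome) : Fin K → Fin N := ω.1

/-- The metadata `M(C_k)` of the cached content of user `k`. -/
def cacheMeta (k : Fin K) (ω : S.Outcome) : S.CacheMeta k := ω.2.1 k

/-- The metadata `M(P_k)` of the packets of user `k`. -/
def packetMeta (k : Fin K) (ω : S.Outcome) : S.PacketMeta k := ω.2.2.1 k

/-- The library `(F_1, …, F_N)`. -/
def library (ω : S.Outcome) : Library N B := ω.2.2.2

/-- The cached content `C_k`: the stored bits at their positions, blank elsewhere. -/
def cacheContent (k : Fin K) (ω : S.Outcome) : Fin N → Fin B → Option Bool := fun n b =>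
  if (n, b) ∈ S.stored k (S.cacheMeta k ω) then some (S.library ω n b) else none

/-- The cache `Z_k = (M(C_k), C_k)`. -/
def cache (k : Fin K) (ω : S.Outcome) : S.CacheMeta k × (Fin N → Fin B → Option Bool) :=
  (S.cacheMeta k ω, S.cacheContent k ω)

/-- The transmission `X_k = (M(P_k), P_k)`. -/
def signal (k : Fin K) (ω : S.Outcome) : S.PacketMeta k × S.Packet k :=
  (S.packetMeta k ω, S.compose k (S.packetMeta k ω) (S.library ω))

/-- All transmissions `X = (X_1, …, X_K)`. -/
def signals (ω : S.Outcome) : (k : Fin K) → S.PacketMeta k × S.Packet k :=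
  fun k => S.signal k ω

/-- The file `F_{D_k}` demanded by user `k`. -/
def demandedFile (k : Fin K) (ω : S.Outcome) : Fin B → Bool :=
  S.library ω (S.demands ω k)

/-- The scheme is a private caching scheme with cache size `M`, load `R` and slack `ε`, for demands
distributed according to `demandLaw`. -/
structure Works (demandLaw : PMF (Fin K → Fin N)) (M R ε : ℝ) : Prop where
  cache_size : ∀ k, entropy (S.law demandLaw) (S.cache k) ≤ B * (M + ε)
  encoding : ∀ k, condEntropy (S.law demandLaw) (S.signal k)
    (fun ω => (S.packetMeta k ω, S.cache k ω)) = 0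
  decoding : ∀ k, condEntropy (S.law demandLaw) (S.demandedFile k)
    (fun ω => (S.signals ω, S.cache k ω, S.demands ω k)) ≤ B * ε
  privacy : ∀ k, condMutualInfo (S.law demandLaw) S.demands
    (fun ω => (S.signals ω, S.cache k ω)) (fun ω => S.demands ω k) = 0
  load : ∑ k, entropy (S.law demandLaw) (S.signal k) ≤ B * (R + ε)

end Scheme

/-- The load `R` is achievable for cache size `M` under uncoded cache placement: for all large file
sizes `B` there is a working scheme, with slack `ε_B` tending to `0` as `B → ∞`. -/
def Achievable {K N : ℕ} (demandLaw : PMF (Fin K → Fin N)) (M R : ℝ) : Prop :=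
  ∃ ε : ℕ → ℝ, (∀ B, 0 ≤ ε B) ∧ Tendsto ε atTop (𝓝 0) ∧
    ∀ᶠ B : ℕ in atTop, ∃ S : Scheme K N B, S.Works demandLaw M R (ε B)

/-- The optimal load under uncoded cache placement: the infimum of the achievable loads
(`⊤` if there were none). -/
def optimalLoad {K N : ℕ} (demandLaw : PMF (Fin K → Fin N)) (M : ℝ) : EReal :=
  ⨅ (R : ℝ) (_ : Achievable demandLaw M R), (R : EReal)

end D2DCaching

end

/-!
A packet `X` cannot serve many demands at once. Reveal the files one after the other in a random
order, each time adding the cache of a user that demands the next file: since the bits of a library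
are independent, a bit of file `n` is new unless an earlier cache already stores it, so a bit stored
in `t` of the competing caches is paid for with probability `1 / (t + 1)`. Hence `H(X)` is at least
the number of missing bits, counted with weight `1 / (t + 1)` or with any linear minorant `A - C t`.

By privacy the law of the packet metadata does not depend on the demands, so one composition of the
packets may be combined with caches drawn for each of the `N` demands `(n, n)`. A user computes its
own packet from its cache, so only the other user's packet helps it; hence, up to the slack, the
cache of one user in any of these draws and that of the other user in any of them store the whole
library. The bits of file `n` that a user lacks in the draw for demand `n` but stores in the draw
for demand `l`, summed over the users, are therefore at most the bits of file `n` that both users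
store in the latter draw. Averaging over the draws turns this into a bound on the load in terms of
the cache size, for every admissible `A` and `C`, and the slack vanishes in the limit.
-/

namespace D2DCaching

section Mean

variable {α β γ ι : Type*}

lemma sum_toReal [Fintype α] (P : PMF α) : ∑ a, (P a).toReal = 1 := by
  rw [← ENNReal.toReal_sum fun a _ => P.apply_ne_top a, ← tsum_fintype (L := .unconditional α),
    P.tsum_coe, ENNReal.toReal_one]

lemma toReal_map_apply [Fintype α] [DecidableEq β] (P : PMF α) (g : α → β) (b : β) :
    ((P.map g) b).toReal = ∑ a with g a = b, (P a).toReal := by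
  rw [PMF.map_apply, tsum_fintype, Finset.sum_filter, ENNReal.toReal_sum fun a _ => by
    split_ifs; exacts [P.apply_ne_top a, ENNReal.zero_ne_top]]
  refine Finset.sum_congr rfl fun a _ => ?_
  obtain rfl | hne := eq_or_ne (g a) b
  · rw [if_pos rfl, if_pos rfl]
  · rw [if_neg hne, if_neg hne.symm, ENNReal.toReal_zero]

/-- The expectation of a real function under a law on a finite type. -/
noncomputable def mean [Fintype α] (P : PMF α) (f : α → ℝ) : ℝ := ∑ a, (P a).toReal * f a

lemma mean_const [Fintype α] (P : PMF α) (r : ℝ) : mean P (fun _ => r) = r := by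
  rw [mean, ← Finset.sum_mul, sum_toReal, one_mul]

lemma mean_add [Fintype α] (P : PMF α) (f g : α → ℝ) :
    mean P (fun a => f a + g a) = mean P f + mean P g := by
  simp only [mean, mul_add, Finset.sum_add_distrib]

lemma mean_sub [Fintype α] (P : PMF α) (f g : α → ℝ) :
    mean P (fun a => f a - g a) = mean P f - mean P g := by
  simp only [mean, mul_sub, Finset.sum_sub_distrib]

lemma mean_const_mul [Fintype α] (P : PMF α) (r : ℝ) (f : α → ℝ) :
    mean P (fun a => r * f a) = r * mean P f := by
  simp only [mean, Finset.mul_sum, mul_left_comm]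

lemma mean_sum [Fintype α] (P : PMF α) (s : Finset ι) (f : ι → α → ℝ) :
    mean P (fun a => ∑ i ∈ s, f i a) = ∑ i ∈ s, mean P (f i) := by
  simp only [mean, Finset.mul_sum]
  exact Finset.sum_comm

lemma mean_map [Fintype α] [Fintype β] (P : PMF α) (g : α → β) (f : β → ℝ) :
    mean (P.map g) f = mean P fun a => f (g a) := by
  classical
  simp only [mean, toReal_map_apply, Finset.sum_mul]
  rw [← Finset.sum_fiberwise (g := g)]
  refine Finset.sum_congr rfl fun b _ => Finset.sum_congr rfl fun a ha => ?_
  rw [(Finset.mem_filter.1 ha).2]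

lemma mean_le_mean [Fintype α] {P : PMF α} {f g : α → ℝ} (h : ∀ a ∈ P.support, f a ≤ g a) :
    mean P f ≤ mean P g := by
  refine Finset.sum_le_sum fun a _ => ?_
  by_cases ha : P a = 0
  · simp [ha]
  · exact mul_le_mul_of_nonneg_left (h a ha) ENNReal.toReal_nonneg

lemma mean_nonneg [Fintype α] {P : PMF α} {f : α → ℝ} (hf : ∀ a, 0 ≤ f a) : 0 ≤ mean P f :=
  Finset.sum_nonneg fun a _ => mul_nonneg ENNReal.toReal_nonneg (hf a)

lemma eq_zero_of_mean_eq_zero [Fintype α] {P : PMF α} {f : α → ℝ} (hf : ∀ a, 0 ≤ f a)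
    (h : mean P f = 0) {a : α} (ha : a ∈ P.support) : f a = 0 := by
  have hterm := (Finset.sum_eq_zero_iff_of_nonneg fun a _ =>
    mul_nonneg ENNReal.toReal_nonneg (hf a)).1 h a (Finset.mem_univ a)
  exact (mul_eq_zero.1 hterm).resolve_left
    (ENNReal.toReal_pos ((P.mem_support_iff a).1 ha) (P.apply_ne_top a)).ne'

lemma toReal_mul_le_mean [Fintype α] (P : PMF α) {f : α → ℝ} (hf : ∀ a, 0 ≤ f a) (a : α) :
    (P a).toReal * f a ≤ mean P f :=
  Finset.single_le_sum (f := fun a => (P a).toReal * f a)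
    (fun a _ => mul_nonneg ENNReal.toReal_nonneg (hf a)) (Finset.mem_univ a)

/-- The joint law of a `P`-distributed variable and a variable with conditional law `κ` given the
first. -/
noncomputable def joint (P : PMF α) (κ : α → PMF β) : PMF (α × β) :=
  P.bind fun a => (κ a).map (Prod.mk a)

lemma joint_apply (P : PMF α) (κ : α → PMF β) (a : α) (b : β) :
    joint P κ (a, b) = P a * κ a b := by
  classical
  rw [joint, PMF.bind_apply, tsum_eq_single a, PMF.map_apply, tsum_eq_single b, if_pos rfl]
  · exact fun b' hb => if_neg fun h => hb (Prod.mk.inj h).2.symm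
  · intro a' ha
    simp [PMF.map_apply, ha.symm]

lemma mem_support_joint {P : PMF α} {κ : α → PMF β} {x : α × β} :
    x ∈ (joint P κ).support ↔ x.1 ∈ P.support ∧ x.2 ∈ (κ x.1).support := by
  obtain ⟨a, b⟩ := x
  simp only [PMF.mem_support_iff, joint_apply, mul_ne_zero_iff]

lemma map_fst_joint (P : PMF α) (κ : α → PMF β) : (joint P κ).map Prod.fst = P := by
  have hconst (a : α) : (κ a).map (fun _ => a) = PMF.pure a := PMF.map_const _ _
  simp only [joint, PMF.map_bind, PMF.map_comp, Function.comp_def, hconst, PMF.bind_pure]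

lemma map_joint_comp {δ : Type*} (P : PMF α) (m : α → γ) (κ : γ → PMF β) (g : γ → β → δ) :
    (joint P fun a => κ (m a)).map (fun x => (m x.1, g (m x.1) x.2))
      = joint (P.map m) fun c => (κ c).map (g c) := by
  simp only [joint, PMF.map_bind, PMF.bind_map, PMF.map_comp, Function.comp_def]

lemma mean_joint [Fintype α] [Fintype β] (P : PMF α) (κ : α → PMF β) (f : α × β → ℝ) :
    mean (joint P κ) f = mean P fun a => mean (κ a) fun b => f (a, b) := by
  simp only [mean, Fintype.sum_prod_type, joint_apply, ENNReal.toReal_mul, Finset.mul_sum,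
    mul_assoc]

lemma mean_comp_fst_joint [Fintype α] [Fintype β] (P : PMF α) (κ : α → PMF β) (f : α → ℝ) :
    mean (joint P κ) (fun x => f x.1) = mean P f := by
  simp only [mean_joint, mean_const]

lemma toReal_map_snd_apply [Fintype α] [Finite β] (Q : PMF (α × β)) (b : β) :
    ((Q.map Prod.snd) b).toReal = ∑ a, (Q (a, b)).toReal := by
  classical
  have := Fintype.ofFinite β
  rw [toReal_map_apply, Finset.sum_filter, Fintype.sum_prod_type]
  simp only [Finset.sum_ite_eq', Finset.mem_univ, if_true]

lemma exists_mem_support_sum_mul_le [Fintype α] [Finite β] {Q : PMF (α × β)} {b : β}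
    (hb : (Q.map Prod.snd) b ≠ 0) (φ : α × β → ℝ) :
    ∃ a, (a, b) ∈ Q.support ∧
      ∑ a', (Q (a', b)).toReal * φ (a', b) ≤ ((Q.map Prod.snd) b).toReal * φ (a, b) := by
  classical
  have hne : (Finset.univ.filter fun a => (a, b) ∈ Q.support).Nonempty := by
    obtain ⟨⟨a, _⟩, ha, rfl⟩ := (PMF.mem_support_map_iff ..).1 ((PMF.mem_support_iff ..).2 hb)
    exact ⟨a, by simpa using ha⟩
  obtain ⟨a, ha, hmax⟩ := Finset.exists_max_image _ (fun a => φ (a, b)) hne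
  refine ⟨a, (Finset.mem_filter.1 ha).2, ?_⟩
  rw [toReal_map_snd_apply, Finset.sum_mul]
  refine Finset.sum_le_sum fun a' _ => ?_
  by_cases ha' : Q (a', b) = 0
  · simp [ha']
  · exact mul_le_mul_of_nonneg_left (hmax a' (by simpa using ha')) ENNReal.toReal_nonneg

lemma sum_mean_le_mean_of_forall_selection [Fintype α] [Fintype β] [Fintype ι]
    {Q : ι → PMF (α × β)} {ρ : PMF β} (hρ : ∀ i, (Q i).map Prod.snd = ρ) {φ : ι → α × β → ℝ}
    {H : β → ℝ}
    (h : ∀ b, ∀ f : ι → α, (∀ i, (f i, b) ∈ (Q i).support) → ∑ i, φ i (f i, b) ≤ H b) :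
    ∑ i, mean (Q i) (φ i) ≤ mean ρ H := by
  simp only [mean, Fintype.sum_prod_type_right]
  rw [Finset.sum_comm]
  refine Finset.sum_le_sum fun b _ => ?_
  by_cases hb : ρ b = 0
  · have hzero (i : ι) (a : α) : (Q i (a, b)).toReal = 0 := by
      refine (Finset.sum_eq_zero_iff_of_nonneg (f := fun a => (Q i (a, b)).toReal)
        fun _ _ => ENNReal.toReal_nonneg).1 ?_ a (Finset.mem_univ a)
      rw [← toReal_map_snd_apply, hρ i, hb, ENNReal.toReal_zero]
    simp only [hzero, hb, ENNReal.toReal_zero, zero_mul, Finset.sum_const_zero, le_refl]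
  · choose f hf hmax using fun i => exists_mem_support_sum_mul_le (Q := Q i) (hρ i ▸ hb) (φ i)
    calc ∑ i, ∑ a, (Q i (a, b)).toReal * φ i (a, b)
        ≤ ∑ i, (ρ b).toReal * φ i (f i, b) :=
          Finset.sum_le_sum fun i _ => (hmax i).trans_eq (by rw [hρ i])
      _ = (ρ b).toReal * ∑ i, φ i (f i, b) := (Finset.mul_sum ..).symm
      _ ≤ (ρ b).toReal * H b := mul_le_mul_of_nonneg_left (h b f hf) ENNReal.toReal_nonneg

end Mean

section Entropy

variable {Ω α β γ : Type}

/-- The probability that a random variable takes a given value. -/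
noncomputable def prob (P : PMF Ω) (X : Ω → α) (a : α) : ℝ := ((P.map X) a).toReal

lemma prob_nonneg (P : PMF Ω) (X : Ω → α) (a : α) : 0 ≤ prob P X a := ENNReal.toReal_nonneg

lemma sum_prob [Fintype α] (P : PMF Ω) (X : Ω → α) : ∑ a, prob P X a = 1 := sum_toReal _

lemma prob_le_one (P : PMF Ω) (X : Ω → α) (a : α) : prob P X a ≤ 1 :=
  ENNReal.toReal_le_of_le_ofReal zero_le_one (by simpa using (P.map X).coe_le_one a)

lemma prob_comp [Fintype β] [DecidableEq α] (P : PMF Ω) (Y : Ω → β) (g : β → α) (a : α) :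
    prob P (fun ω => g (Y ω)) a = ∑ b with g b = a, prob P Y b := by
  rw [prob, ← Function.comp_def, ← PMF.map_comp, toReal_map_apply]
  rfl

lemma prob_le_prob_comp [Finite β] (P : PMF Ω) (Y : Ω → β) (g : β → α) (b : β) :
    prob P Y b ≤ prob P (fun ω => g (Y ω)) (g b) := by
  classical
  have := Fintype.ofFinite β
  rw [prob_comp P Y g]
  exact Finset.single_le_sum (fun b' _ => prob_nonneg P Y b') (by simp)

lemma sum_prob_prodMk_left [Fintype α] [Finite β] (P : PMF Ω) (X : Ω → α) (Y : Ω → β) (b : β) :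
    ∑ a, prob P (fun ω => (X ω, Y ω)) (a, b) = prob P Y b := by
  simp only [prob]
  rw [← toReal_map_snd_apply, PMF.map_comp]
  rfl

lemma entropy_comp_mul_log_two [Fintype α] [Fintype β] (P : PMF Ω) (Y : Ω → β) (g : β → α) :
    entropy P (fun ω => g (Y ω)) * Real.log 2
      = -∑ b, prob P Y b * Real.log (prob P (fun ω => g (Y ω)) (g b)) := by
  calc entropy P (fun ω => g (Y ω)) * Real.log 2
      = ∑ a, Real.negMulLog ((P.map fun ω => g (Y ω)) a).toReal :=
        div_mul_cancel₀ _ (Real.log_pos one_lt_two).ne'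
    _ = -mean (P.map fun ω => g (Y ω)) fun a => Real.log (prob P (fun ω => g (Y ω)) a) := by
        simp only [mean, prob, Real.negMulLog_eq_neg, Finset.sum_neg_distrib]
    _ = -∑ b, prob P Y b * Real.log (prob P (fun ω => g (Y ω)) (g b)) := by
        rw [← Function.comp_def, ← PMF.map_comp, mean_map]
        rfl

lemma entropy_mul_log_two [Fintype α] (P : PMF Ω) (X : Ω → α) :
    entropy P X * Real.log 2 = -∑ a, prob P X a * Real.log (prob P X a) :=
  entropy_comp_mul_log_two P X id

lemma entropy_nonneg [Fintype α] (P : PMF Ω) (X : Ω → α) : 0 ≤ entropy P X :=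
  div_nonneg (Finset.sum_nonneg fun a _ =>
    Real.negMulLog_nonneg (prob_nonneg P X a) (prob_le_one P X a)) (Real.log_pos one_lt_two).le

lemma entropy_const [Fintype α] (P : PMF Ω) (a : α) : entropy P (fun _ => a) = 0 := by
  classical
  have hmap : P.map (fun _ => a) = PMF.pure a := PMF.map_const P a
  simp only [entropy, hmap, PMF.pure_apply, apply_ite ENNReal.toReal]
  simp [apply_ite Real.negMulLog]

lemma entropy_le_of_factorsThrough [Fintype α] [Fintype β] (P : PMF Ω) {X : Ω → α} {Y : Ω → β}
    (h : X.FactorsThrough Y) : entropy P X ≤ entropy P Y := by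
  obtain ⟨ω₀, -⟩ := P.support_nonempty
  have : Nonempty α := ⟨X ω₀⟩
  obtain ⟨g, rfl⟩ := (Function.factorsThrough_iff X).1 h
  refine le_of_mul_le_mul_right ?_ (Real.log_pos one_lt_two)
  rw [entropy_mul_log_two P Y, Function.comp_def, entropy_comp_mul_log_two P Y g]
  refine neg_le_neg (Finset.sum_le_sum fun b _ => ?_)
  rcases (prob_nonneg P Y b).eq_or_lt with hzero | hpos
  · simp [← hzero]
  · exact mul_le_mul_of_nonneg_left (Real.log_le_log hpos (prob_le_prob_comp P Y g b)) hpos.le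

lemma entropy_congr [Fintype α] [Fintype β] (P : PMF Ω) {X : Ω → α} {Y : Ω → β}
    (h : ∀ ω ω', X ω = X ω' ↔ Y ω = Y ω') : entropy P X = entropy P Y :=
  le_antisymm (entropy_le_of_factorsThrough P fun ω ω' => (h ω ω').2)
    (entropy_le_of_factorsThrough P fun ω ω' => (h ω ω').1)

lemma entropy_prodMk_assoc [Fintype α] [Fintype β] [Fintype γ] (P : PMF Ω) (X : Ω → α)
    (Y : Ω → β) (Z : Ω → γ) :
    entropy P (fun ω => ((X ω, Y ω), Z ω)) = entropy P (fun ω => (X ω, Y ω, Z ω)) :=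
  entropy_congr P fun ω ω' => by simp only [Prod.mk.injEq, and_assoc]

lemma entropy_prodMk_left_comm [Fintype α] [Fintype β] [Fintype γ] (P : PMF Ω) (X : Ω → α)
    (Y : Ω → β) (Z : Ω → γ) :
    entropy P (fun ω => (X ω, Y ω, Z ω)) = entropy P (fun ω => (Y ω, X ω, Z ω)) :=
  entropy_congr P fun ω ω' => by simp only [Prod.mk.injEq, and_left_comm]

lemma condEntropy_nonneg [Fintype α] [Fintype β] (P : PMF Ω) (X : Ω → α) (Y : Ω → β) :
    0 ≤ condEntropy P X Y :=
  sub_nonneg.2 (entropy_le_of_factorsThrough P fun _ _ h => (Prod.mk.inj h).2)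

lemma condEntropy_congr {α' β' : Type} [Fintype α] [Fintype β] [Fintype α'] [Fintype β']
    (P : PMF Ω) {X : Ω → α} {Y : Ω → β} {X' : Ω → α'} {Y' : Ω → β'}
    (hY : ∀ ω ω', Y ω = Y ω' ↔ Y' ω = Y' ω')
    (hX : ∀ ω ω', Y ω = Y ω' → (X ω = X ω' ↔ X' ω = X' ω')) :
    condEntropy P X Y = condEntropy P X' Y' := by
  rw [condEntropy, condEntropy, entropy_congr P hY]
  congr 1
  refine entropy_congr P fun ω ω' => ?_
  rw [Prod.mk.injEq, Prod.mk.injEq, ← hY, and_congr_left (hX ω ω')]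

/-- The probability that the triple `(X, Y, Z)` would have if `X` and `Y` were conditionally
independent given `Z`, with the same laws of `(X, Z)` and `(Y, Z)`. -/
noncomputable def condIndepProb (P : PMF Ω) (X : Ω → α) (Y : Ω → β) (Z : Ω → γ)
    (t : α × β × γ) : ℝ :=
  prob P (fun ω => (X ω, Z ω)) (t.1, t.2.2) * prob P (fun ω => (Y ω, Z ω)) t.2 / prob P Z t.2.2

lemma condIndepProb_nonneg (P : PMF Ω) (X : Ω → α) (Y : Ω → β) (Z : Ω → γ) (t : α × β × γ) :
    0 ≤ condIndepProb P X Y Z t :=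
  div_nonneg (mul_nonneg (prob_nonneg _ _ _) (prob_nonneg _ _ _)) (prob_nonneg _ _ _)

lemma prob_marginals_pos [Finite α] [Finite β] [Finite γ] {P : PMF Ω} {X : Ω → α} {Y : Ω → β}
    {Z : Ω → γ} {t : α × β × γ} (h : 0 < prob P (fun ω => (X ω, Y ω, Z ω)) t) :
    0 < prob P (fun ω => (X ω, Z ω)) (t.1, t.2.2) ∧ 0 < prob P (fun ω => (Y ω, Z ω)) t.2 ∧
      0 < prob P Z t.2.2 :=
  ⟨h.trans_le (prob_le_prob_comp P _ (fun t => (t.1, t.2.2)) t),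
    h.trans_le (prob_le_prob_comp P _ (fun t => t.2) t),
    h.trans_le (prob_le_prob_comp P _ (fun t => t.2.2) t)⟩

lemma prob_eq_zero_of_condIndepProb_eq_zero [Finite α] [Finite β] [Finite γ] {P : PMF Ω}
    {X : Ω → α} {Y : Ω → β} {Z : Ω → γ} {t : α × β × γ} (h : condIndepProb P X Y Z t = 0) :
    prob P (fun ω => (X ω, Y ω, Z ω)) t = 0 := by
  by_contra hne
  obtain ⟨hXZ, hYZ, hZ⟩ := prob_marginals_pos ((prob_nonneg _ _ _).lt_of_ne' hne)
  exact (div_pos (mul_pos hXZ hYZ) hZ).ne' h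

lemma prob_mul_log_condIndepProb [Finite α] [Finite β] [Finite γ] (P : PMF Ω)
    (X : Ω → α) (Y : Ω → β) (Z : Ω → γ) (t : α × β × γ) :
    prob P (fun ω => (X ω, Y ω, Z ω)) t * Real.log (condIndepProb P X Y Z t)
      = prob P (fun ω => (X ω, Y ω, Z ω)) t * (Real.log (prob P (fun ω => (X ω, Z ω)) (t.1, t.2.2))
        + Real.log (prob P (fun ω => (Y ω, Z ω)) t.2) - Real.log (prob P Z t.2.2)) := by
  rcases (prob_nonneg P (fun ω => (X ω, Y ω, Z ω)) t).eq_or_lt with hzero | hpos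
  · rw [← hzero, zero_mul, zero_mul]
  · obtain ⟨hXZ, hYZ, hZ⟩ := prob_marginals_pos hpos
    rw [condIndepProb, Real.log_div (mul_pos hXZ hYZ).ne' hZ.ne', Real.log_mul hXZ.ne' hYZ.ne']

lemma sum_condIndepProb [Fintype α] [Fintype β] [Fintype γ] (P : PMF Ω)
    (X : Ω → α) (Y : Ω → β) (Z : Ω → γ) : ∑ t, condIndepProb P X Y Z t = 1 := by
  calc ∑ t, condIndepProb P X Y Z t
      = ∑ c, ∑ b, ∑ a, prob P (fun ω => (X ω, Z ω)) (a, c) * prob P (fun ω => (Y ω, Z ω)) (b, c)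
          / prob P Z c := by
        rw [Fintype.sum_prod_type_right, Fintype.sum_prod_type_right]; rfl
    _ = ∑ c, prob P Z c := by
        refine Finset.sum_congr rfl fun c _ => ?_
        simp only [← Finset.sum_div, ← Finset.sum_mul, ← Finset.mul_sum, sum_prob_prodMk_left,
          mul_self_div_self]
    _ = 1 := sum_prob P Z

lemma mul_klFun_div {p q : ℝ} (h : q = 0 → p = 0) :
    q * InformationTheory.klFun (p / q) = p * (Real.log p - Real.log q) + q - p := by
  rcases eq_or_ne q 0 with rfl | hq
  · simp [h rfl]
  · rcases eq_or_ne p 0 with rfl | hp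
    · simp [InformationTheory.klFun_apply]
    · rw [InformationTheory.klFun_apply, Real.log_div hp hq]
      field_simp

lemma condMutualInfo_mul_log_two [Fintype α] [Fintype β] [Fintype γ] (P : PMF Ω)
    (X : Ω → α) (Y : Ω → β) (Z : Ω → γ) :
    condMutualInfo P X Y Z * Real.log 2 = ∑ t, condIndepProb P X Y Z t *
      InformationTheory.klFun (prob P (fun ω => (X ω, Y ω, Z ω)) t / condIndepProb P X Y Z t) := by
  have hXZ := entropy_comp_mul_log_two P (fun ω => (X ω, Y ω, Z ω)) fun t => (t.1, t.2.2)
  have hYZ := entropy_comp_mul_log_two P (fun ω => (X ω, Y ω, Z ω)) fun t => t.2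
  have hZ := entropy_comp_mul_log_two P (fun ω => (X ω, Y ω, Z ω)) fun t => t.2.2
  have hXYZ := entropy_mul_log_two P (fun ω => (X ω, Y ω, Z ω))
  simp only [mul_klFun_div prob_eq_zero_of_condIndepProb_eq_zero, mul_sub, mul_add,
    prob_mul_log_condIndepProb, Finset.sum_sub_distrib, Finset.sum_add_distrib,
    sum_condIndepProb, sum_prob, condMutualInfo, condEntropy, entropy_prodMk_assoc]
  linear_combination hXZ + hYZ - hZ - hXYZ

lemma condIndepProb_mul_klFun_nonneg (P : PMF Ω) (X : Ω → α) (Y : Ω → β) (Z : Ω → γ)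
    (t : α × β × γ) : 0 ≤ condIndepProb P X Y Z t *
      InformationTheory.klFun (prob P (fun ω => (X ω, Y ω, Z ω)) t / condIndepProb P X Y Z t) :=
  mul_nonneg (condIndepProb_nonneg ..)
    (InformationTheory.klFun_nonneg (div_nonneg (prob_nonneg ..) (condIndepProb_nonneg ..)))

lemma condMutualInfo_nonneg [Fintype α] [Fintype β] [Fintype γ] (P : PMF Ω)
    (X : Ω → α) (Y : Ω → β) (Z : Ω → γ) : 0 ≤ condMutualInfo P X Y Z := by
  refine nonneg_of_mul_nonneg_left ?_ (Real.log_pos one_lt_two)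
  rw [condMutualInfo_mul_log_two]
  exact Finset.sum_nonneg fun t _ => condIndepProb_mul_klFun_nonneg P X Y Z t

lemma prob_eq_condIndepProb_of_condMutualInfo_eq_zero [Fintype α] [Fintype β] [Fintype γ]
    {P : PMF Ω} {X : Ω → α} {Y : Ω → β} {Z : Ω → γ} (h : condMutualInfo P X Y Z = 0)
    (t : α × β × γ) :
    prob P (fun ω => (X ω, Y ω, Z ω)) t = condIndepProb P X Y Z t := by
  have hsum := condMutualInfo_mul_log_two P X Y Z
  rw [h, zero_mul, eq_comm, Finset.sum_eq_zero_iff_of_nonneg fun t _ =>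
    condIndepProb_mul_klFun_nonneg P X Y Z t] at hsum
  rcases eq_or_ne (condIndepProb P X Y Z t) 0 with hzero | hne
  · rw [hzero, prob_eq_zero_of_condIndepProb_eq_zero hzero]
  · have hkl := (mul_eq_zero.1 (hsum t (Finset.mem_univ t))).resolve_left hne
    rw [InformationTheory.klFun_eq_zero_iff (div_nonneg (prob_nonneg ..)
      (condIndepProb_nonneg ..))] at hkl
    exact (div_eq_one_iff_eq hne).1 hkl

lemma condMutualInfo_eq_condEntropy_sub [Fintype α] [Fintype β] [Fintype γ] (P : PMF Ω)
    (X : Ω → α) (Y : Ω → β) (Z : Ω → γ) :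
    condMutualInfo P X Y Z = condEntropy P X Z - condEntropy P X (fun ω => (Y ω, Z ω)) := by
  simp only [condMutualInfo, condEntropy, entropy_prodMk_assoc]
  ring

lemma condEntropy_prodMk_le [Fintype α] [Fintype β] [Fintype γ] (P : PMF Ω)
    (X : Ω → α) (Y : Ω → β) (Z : Ω → γ) :
    condEntropy P X (fun ω => (Y ω, Z ω)) ≤ condEntropy P X Z :=
  sub_nonneg.1 ((condMutualInfo_nonneg P X Y Z).trans_eq
    (condMutualInfo_eq_condEntropy_sub P X Y Z))

lemma condEntropy_le_of_factorsThrough [Fintype α] [Fintype β] [Fintype γ] (P : PMF Ω)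
    (X : Ω → α) {Y : Ω → β} {Z : Ω → γ} (h : Z.FactorsThrough Y) :
    condEntropy P X Y ≤ condEntropy P X Z := by
  calc condEntropy P X Y = condEntropy P X (fun ω => (Y ω, Z ω)) :=
        condEntropy_congr P (fun ω ω' => by
          rw [Prod.mk.injEq, iff_self_and]; exact fun hY => h hY) fun _ _ _ => Iff.rfl
    _ ≤ condEntropy P X Z := condEntropy_prodMk_le P X Y Z

lemma condEntropy_le_entropy [Fintype α] [Fintype β] (P : PMF Ω) (X : Ω → α) (Y : Ω → β) :
    condEntropy P X Y ≤ entropy P X := by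
  calc condEntropy P X Y ≤ condEntropy P X (fun _ => ()) :=
        condEntropy_le_of_factorsThrough P X fun _ _ _ => rfl
    _ = entropy P X := by
        rw [condEntropy, entropy_const, sub_zero]
        exact entropy_congr P fun ω ω' => by simp only [Prod.mk.injEq, and_true]

lemma condEntropy_add_comm [Fintype α] [Fintype β] [Fintype γ] (P : PMF Ω)
    (X : Ω → α) (Y : Ω → β) (Z : Ω → γ) :
    condEntropy P Y Z + condEntropy P X (fun ω => (Y ω, Z ω))
      = condEntropy P X Z + condEntropy P Y (fun ω => (X ω, Z ω)) := by
  simp only [condEntropy, entropy_prodMk_left_comm P X Y Z]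
  ring

lemma condEntropy_le_add [Fintype α] [Fintype β] [Fintype γ] (P : PMF Ω)
    (X : Ω → α) (Y : Ω → β) (Z : Ω → γ) :
    condEntropy P X Z ≤ condEntropy P Y Z + condEntropy P X (fun ω => (Y ω, Z ω)) := by
  rw [condEntropy_add_comm]
  exact le_add_of_nonneg_right (condEntropy_nonneg P Y _)

lemma condMutualInfo_eq_zero_of_factorsThrough {δ : Type} [Fintype α] [Fintype β] [Fintype γ]
    [Fintype δ] (P : PMF Ω) {X : Ω → α} {Y : Ω → β} {Z : Ω → γ} {W : Ω → δ}
    (hW : W.FactorsThrough Y) (h : condMutualInfo P X Y Z = 0) : condMutualInfo P X W Z = 0 := by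
  refine le_antisymm ?_ (condMutualInfo_nonneg P X W Z)
  have hmono : condEntropy P X (fun ω => (Y ω, Z ω)) ≤ condEntropy P X (fun ω => (W ω, Z ω)) :=
    condEntropy_le_of_factorsThrough P X fun ω ω' hYZ => by
      rw [Prod.mk.injEq] at hYZ ⊢
      exact ⟨hW hYZ.1, hYZ.2⟩
  rw [condMutualInfo_eq_condEntropy_sub] at h ⊢
  linarith

lemma prob_comp_of_injective [Finite α] (P : PMF Ω) (X : Ω → α) {g : α → β}
    (hg : g.Injective) (a : α) : prob P (fun ω => g (X ω)) (g a) = prob P X a := by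
  classical
  have := Fintype.ofFinite α
  rw [prob_comp P X g, Finset.sum_filter]
  simp only [hg.eq_iff, Finset.sum_ite_eq', Finset.mem_univ, if_true]

lemma prob_mul_prob_comm_of_condMutualInfo_eq_zero [Fintype α] [Fintype β] [Fintype γ]
    {P : PMF Ω} {X : Ω → α} {Y : Ω → β} {g : α → γ}
    (h : condMutualInfo P X Y (fun ω => g (X ω)) = 0) {x x' : α} (hg : g x = g x') (y : β) :
    prob P (fun ω => (X ω, Y ω)) (x, y) * prob P X x'
      = prob P (fun ω => (X ω, Y ω)) (x', y) * prob P X x := by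
  have hindep (a : α) : prob P (fun ω => (X ω, Y ω)) (a, y) = prob P X a *
      (prob P (fun ω => (Y ω, g (X ω))) (y, g a) / prob P (fun ω => g (X ω)) (g a)) := by
    rw [← mul_div_assoc, ← prob_comp_of_injective P X (g := fun a => (a, g a))
        (fun _ _ h => (Prod.mk.inj h).1),
      ← prob_comp_of_injective P (fun ω => (X ω, Y ω)) (g := fun t => (t.1, t.2, g t.1))
        (fun _ _ h => Prod.ext (Prod.mk.inj h).1 (Prod.mk.inj (Prod.mk.inj h).2).1)]
    exact prob_eq_condIndepProb_of_condMutualInfo_eq_zero h (a, y, g a)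
  rw [hindep x, hindep x', hg]
  ring

lemma entropy_map [Fintype β] (P : PMF Ω) (f : Ω → α) (X : α → β) :
    entropy (P.map f) X = entropy P fun ω => X (f ω) := by
  rw [entropy, PMF.map_comp, entropy, Function.comp_def]

lemma condEntropy_map [Fintype β] [Fintype γ] (P : PMF Ω) (f : Ω → α) (X : α → β) (Y : α → γ) :
    condEntropy (P.map f) X Y = condEntropy P (fun ω => X (f ω)) fun ω => Y (f ω) := by
  rw [condEntropy, entropy_map, entropy_map, condEntropy]

end Entropy

section ConditionalLaw

variable {α β γ δ ε : Type}

lemma prob_joint (P : PMF α) (m : α → γ) (κ : γ → PMF β) (g : γ → β → δ) (c : γ) (d : δ) :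
    prob (joint P fun a => κ (m a)) (fun x => (m x.1, g (m x.1) x.2)) (c, d)
      = prob P m c * prob (κ c) (g c) d := by
  rw [prob, map_joint_comp, joint_apply, ENNReal.toReal_mul]
  rfl

lemma entropy_joint [Fintype α] [Fintype γ] [Fintype δ] (P : PMF α) (m : α → γ) (κ : γ → PMF β)
    (g : γ → β → δ) :
    entropy (joint P fun a => κ (m a)) (fun x => (m x.1, g (m x.1) x.2))
      = entropy P m + mean P fun a => entropy (κ (m a)) (g (m a)) := by
  rw [← mean_map P m fun c => entropy (κ c) (g c)]
  simp only [entropy, mean, ← prob.eq_def, Fintype.sum_prod_type, prob_joint, Real.negMulLog_mul,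
    Finset.sum_add_distrib, ← Finset.sum_mul, ← Finset.mul_sum, sum_prob, one_mul, add_div,
    Finset.sum_div, mul_div_assoc]

lemma condEntropy_joint [Fintype α] [Fintype γ] [Fintype δ] [Fintype ε] (P : PMF α) (m : α → γ)
    (κ : γ → PMF β) (f : γ → β → ε) (g : γ → β → δ) :
    condEntropy (joint P fun a => κ (m a)) (fun x => f (m x.1) x.2)
        (fun x => (m x.1, g (m x.1) x.2))
      = mean P fun a => condEntropy (κ (m a)) (f (m a)) (g (m a)) := by
  rw [condEntropy, entropy_prodMk_left_comm, entropy_joint P m κ fun c b => (f c b, g c b),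
    entropy_joint]
  simp only [condEntropy, mean_sub]
  ring

end ConditionalLaw

section LibraryBits

variable {N B : ℕ} {α : Type} [Fintype α]

/-- The law of a library of independent uniform bits. -/
noncomputable abbrev uniformLibrary (N B : ℕ) : PMF (Library N B) :=
  PMF.uniformOfFintype (Library N B)

/-- The bits of the library at the positions in `s`, blank elsewhere: the content of a cache that
stores the positions `s`. -/
def readBits (s : Finset (Fin N × Fin B)) (F : Library N B) : Fin N → Fin B → Option Bool :=
  fun n b => if (n, b) ∈ s then some (F n b) else none

/-- The positions of the bits of file `n`. -/
def file (n : Fin N) : Finset (Fin N × Fin B) := {n} ×ˢ Finset.univ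

@[simp] lemma mem_file {n : Fin N} {b : Fin N × Fin B} : b ∈ file n ↔ b.1 = n := by
  simp only [file, Finset.mem_product, Finset.mem_singleton, Finset.mem_univ, and_true]

lemma card_file (n : Fin N) : (file n : Finset (Fin N × Fin B)).card = B := by
  simp [file]

lemma readBits_eq_iff {s : Finset (Fin N × Fin B)} {F F' : Library N B} :
    readBits s F = readBits s F' ↔ ∀ n b, (n, b) ∈ s → F n b = F' n b := by
  simp only [funext_iff, readBits]
  refine forall₂_congr fun n b => ?_
  split_ifs with hb <;> simp [hb]

lemma readBits_factorsThrough {s t : Finset (Fin N × Fin B)} (h : s ⊆ t) :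
    (readBits s).FactorsThrough (readBits t) := fun _ _ he =>
  readBits_eq_iff.2 fun n b hb => readBits_eq_iff.1 he n b (h hb)

lemma readBits_file_union_eq_iff {n : Fin N} {s : Finset (Fin N × Fin B)} {F F' : Library N B} :
    readBits (file n ∪ s) F = readBits (file n ∪ s) F' ↔
      (F n, readBits s F) = (F' n, readBits s F') := by
  simp only [readBits_eq_iff, Finset.mem_union, or_imp, forall_and, mem_file, Prod.mk.injEq,
    and_congr_left_iff]
  refine fun _ => ⟨fun h => funext fun b => h n b rfl, ?_⟩
  rintro h _ b rfl
  exact congrFun h b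

lemma card_readBits_fiber (s : Finset (Fin N × Fin B)) (F₀ : Library N B) :
    (Finset.univ.filter fun F => readBits s F = readBits s F₀).card * 2 ^ s.card
      = Fintype.card (Library N B) := by
  have hfiber : (Finset.univ.filter fun F => readBits s F = readBits s F₀)
      = Fintype.piFinset fun n => Fintype.piFinset fun b =>
        if (n, b) ∈ s then {F₀ n b} else Finset.univ := by
    ext F
    simp only [Finset.mem_filter, Finset.mem_univ, true_and, readBits_eq_iff, Fintype.mem_piFinset]
    refine forall₂_congr fun n b => ?_
    split_ifs with hb <;> simp [hb]
  have hcard : (Finset.univ.filter fun F => readBits s F = readBits s F₀).card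
      = ∏ b : Fin N × Fin B, if b ∈ s then 1 else 2 := by
    rw [hfiber, Fintype.card_piFinset, Fintype.prod_prod_type]
    refine Finset.prod_congr rfl fun n _ => ?_
    rw [Fintype.card_piFinset]
    refine Finset.prod_congr rfl fun b _ => ?_
    split_ifs <;> simp
  have hpow : (2 : ℕ) ^ s.card = ∏ b : Fin N × Fin B, if b ∈ s then 2 else 1 := by
    rw [Finset.prod_ite_mem, Finset.univ_inter, Finset.prod_const]
  rw [hcard, hpow, ← Finset.prod_mul_distrib]
  calc ∏ b : Fin N × Fin B, ((if b ∈ s then 1 else 2) * if b ∈ s then 2 else 1)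
      = ∏ _b : Fin N × Fin B, 2 := Finset.prod_congr rfl fun b _ => by split_ifs <;> rfl
    _ = Fintype.card (Library N B) := by simp [Library, Fintype.card_pi, pow_mul']

lemma prob_readBits (s : Finset (Fin N × Fin B)) (F₀ : Library N B) :
    prob (uniformLibrary N B) (readBits s) (readBits s F₀) = ((2 : ℝ) ^ s.card)⁻¹ := by
  have hcard : ((Finset.univ.filter fun F => readBits s F = readBits s F₀).card : ℝ) * 2 ^ s.card
      = Fintype.card (Library N B) := by exact_mod_cast card_readBits_fiber s F₀
  rw [prob, toReal_map_apply]
  simp only [PMF.uniformOfFintype_apply, Finset.sum_const, nsmul_eq_mul, ENNReal.toReal_inv,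
    ENNReal.toReal_natCast, ← hcard, mul_inv]
  rw [mul_inv_cancel_left₀]
  exact Nat.cast_ne_zero.2 (Finset.card_ne_zero.2 ⟨F₀, by simp⟩)

lemma entropy_readBits (s : Finset (Fin N × Fin B)) :
    entropy (uniformLibrary N B) (readBits s) = s.card := by
  refine mul_right_cancel₀ (Real.log_pos one_lt_two).ne' ?_
  have h := entropy_comp_mul_log_two (uniformLibrary N B) id (readBits s)
  simp only [id_eq] at h
  simp only [h, prob_readBits, ← Finset.sum_mul, sum_prob, one_mul, Real.log_inv, Real.log_pow,
    neg_neg]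

lemma condEntropy_file (n : Fin N) (s : Finset (Fin N × Fin B)) :
    condEntropy (uniformLibrary N B) (fun F => F n) (readBits s) = (file n \ s).card := by
  have hpair : entropy (uniformLibrary N B) (fun F => (F n, readBits s F))
      = (file n ∪ s : Finset (Fin N × Fin B)).card := by
    rw [← entropy_readBits]
    exact entropy_congr _ fun F F' => readBits_file_union_eq_iff.symm
  rw [condEntropy, hpair, entropy_readBits, ← Finset.card_sdiff_add_card]
  push_cast
  ring

/-- What remains unknown about file `n`, in bits, to a user that knows the value of `Q` and the
bits at the positions `s`. -/
noncomputable def decodingLoss (Q : Library N B → α) (s : Finset (Fin N × Fin B)) (n : Fin N) : ℝ :=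
  condEntropy (uniformLibrary N B) (fun F => F n) (fun F => (Q F, readBits s F))

lemma decodingLoss_nonneg (Q : Library N B → α) (s : Finset (Fin N × Fin B)) (n : Fin N) :
    0 ≤ decodingLoss Q s n := condEntropy_nonneg _ _ _

lemma decodingLoss_le_of_subset (Q : Library N B → α) {s t : Finset (Fin N × Fin B)} (h : s ⊆ t)
    (n : Fin N) : decodingLoss Q t n ≤ decodingLoss Q s n :=
  condEntropy_le_of_factorsThrough _ _ fun _ _ he => by
    rw [Prod.mk.injEq] at he ⊢
    exact ⟨he.1, readBits_factorsThrough h he.2⟩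

lemma card_file_sdiff_union_le_decodingLoss {Q : Library N B → α} {t : Finset (Fin N × Fin B)}
    (hQ : condEntropy (uniformLibrary N B) Q (readBits t) = 0) (s : Finset (Fin N × Fin B))
    (n : Fin N) : ((file n \ (s ∪ t)).card : ℝ) ≤ decodingLoss Q s n := by
  have hQst : condEntropy (uniformLibrary N B) Q (readBits (s ∪ t)) ≤ 0 :=
    hQ ▸ condEntropy_le_of_factorsThrough _ _ (readBits_factorsThrough Finset.subset_union_right)
  calc ((file n \ (s ∪ t)).card : ℝ)
      = condEntropy (uniformLibrary N B) (fun F => F n) (readBits (s ∪ t)) :=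
        (condEntropy_file n _).symm
    _ ≤ condEntropy (uniformLibrary N B) Q (readBits (s ∪ t)) + decodingLoss Q (s ∪ t) n :=
        condEntropy_le_add ..
    _ ≤ decodingLoss Q s n := by
        linarith [decodingLoss_le_of_subset Q (Finset.subset_union_left (s₁ := s) (s₂ := t)) n]

lemma condEntropy_readBits_reveal_le (Q : Library N B → α) (s t : Finset (Fin N × Fin B))
    (n : Fin N) :
    ((file n \ (s ∪ t)).card : ℝ) - decodingLoss Q t n
        + condEntropy (uniformLibrary N B) Q (readBits (file n ∪ (s ∪ t)))
      ≤ condEntropy (uniformLibrary N B) Q (readBits s) := by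
  have hst : condEntropy (uniformLibrary N B) Q (readBits (s ∪ t))
      ≤ condEntropy (uniformLibrary N B) Q (readBits s) :=
    condEntropy_le_of_factorsThrough _ _ (readBits_factorsThrough Finset.subset_union_left)
  have hloss : decodingLoss Q (s ∪ t) n ≤ decodingLoss Q t n :=
    decodingLoss_le_of_subset Q Finset.subset_union_right n
  have hchain : condEntropy (uniformLibrary N B) Q (readBits (s ∪ t)) + decodingLoss Q (s ∪ t) n
      = (file n \ (s ∪ t)).card
        + condEntropy (uniformLibrary N B) Q (fun F => (F n, readBits (s ∪ t) F)) := by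
    rw [decodingLoss, condEntropy_add_comm, condEntropy_file]
  have hfile : condEntropy (uniformLibrary N B) Q (fun F => (F n, readBits (s ∪ t) F))
      = condEntropy (uniformLibrary N B) Q (readBits (file n ∪ (s ∪ t))) :=
    condEntropy_congr _ (fun F F' => readBits_file_union_eq_iff.symm) fun _ _ _ => Iff.rfl
  linarith

end LibraryBits

section Reveal

variable {N B : ℕ} {α : Type} [Fintype α]

/-- The probability with which the bit `b` is counted when the files in `V`, each together with the
bits `c n` of a cache used to decode it, are revealed in uniformly random order to a receiver that
knows the bits in `s`: file `b.1` has to come before every `l` whose cache `c l` contains `b`. -/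
noncomputable def revealWeight (c : Fin N → Finset (Fin N × Fin B)) (V : Finset (Fin N))
    (s : Finset (Fin N × Fin B)) (b : Fin N × Fin B) : ℝ :=
  if b.1 ∈ V ∧ b ∉ s ∧ b ∉ c b.1 then 1 / (((V.filter fun l => b ∈ c l).card : ℝ) + 1) else 0

variable (c : Fin N → Finset (Fin N × Fin B)) (V : Finset (Fin N)) (s : Finset (Fin N × Fin B))
  (b : Fin N × Fin B)

lemma revealWeight_nonneg : 0 ≤ revealWeight c V s b := by
  unfold revealWeight
  split_ifs <;> positivity

lemma revealWeight_erase {m : Fin N} (hm : b.1 ≠ m) (hc : b ∉ c m) :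
    revealWeight c (V.erase m) (file m ∪ (s ∪ c m)) b = revealWeight c V s b := by
  have hfilter : ((V.erase m).filter fun l => b ∈ c l) = V.filter fun l => b ∈ c l := by
    rw [Finset.filter_erase, Finset.erase_eq_of_notMem]
    simp [hc]
  simp [revealWeight, hfilter, hm, hc]

lemma card_mul_revealWeight_le :
    (V.card : ℝ) * revealWeight c V s b ≤ ∑ m ∈ V, ((if b ∈ file m \ (s ∪ c m) then 1 else 0)
      + revealWeight c (V.erase m) (file m ∪ (s ∪ c m)) b) := by
  have hrest (m : Fin N) := revealWeight_nonneg c (V.erase m) (file m ∪ (s ∪ c m)) b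
  by_cases hb : b.1 ∈ V ∧ b ∉ s ∧ b ∉ c b.1
  swap
  · rw [revealWeight, if_neg hb, mul_zero]
    exact Finset.sum_nonneg fun m _ => add_nonneg (by split_ifs <;> norm_num) (hrest m)
  set w := revealWeight c V s b with hw
  rw [revealWeight, if_pos hb] at hw
  obtain ⟨hV, hs, hc⟩ := hb
  have hterm : ∀ m ∈ V, (if b ∈ c m then 0 else w) + (if b.1 = m then 1 - w else 0)
      ≤ (if b ∈ file m \ (s ∪ c m) then 1 else 0)
        + revealWeight c (V.erase m) (file m ∪ (s ∪ c m)) b := by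
    intro m _
    rcases eq_or_ne b.1 m with rfl | hne
    · rw [if_neg hc, if_pos rfl, if_pos (by simp [hs, hc])]
      linarith [hrest b.1]
    · have hbm : b ∉ file m \ (s ∪ c m) := by simp [hne]
      rw [if_neg hne, if_neg hbm, add_zero, zero_add]
      split_ifs with hcm
      · exact hrest m
      · exact (revealWeight_erase c V s b hne hcm).ge
  have hcard : ((V.filter fun l => b ∈ c l).card : ℝ) + (V.filter fun l => b ∉ c l).card = V.card :=
    mod_cast Finset.card_filter_add_card_filter_not (s := V) fun l => b ∈ c l
  have hw_mul : (((V.filter fun l => b ∈ c l).card : ℝ) + 1) * w = 1 := by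
    rw [hw]
    field_simp
  calc (V.card : ℝ) * w = (V.filter fun l => b ∉ c l).card * w + (1 - w) := by
        rw [← hcard]
        linarith
    _ = ∑ m ∈ V, ((if b ∈ c m then 0 else w) + (if b.1 = m then 1 - w else 0)) := by
        rw [Finset.sum_add_distrib, Finset.sum_ite_eq V b.1, if_pos hV, Finset.sum_ite,
          Finset.sum_const_zero, zero_add, Finset.sum_const, nsmul_eq_mul]
    _ ≤ _ := Finset.sum_le_sum hterm

lemma sum_revealWeight_sub_le_condEntropy (Q : Library N B → α) :
    ∑ b, revealWeight c V s b - ∑ n ∈ V, decodingLoss Q (c n) n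
      ≤ condEntropy (uniformLibrary N B) Q (readBits s) := by
  induction hk : V.card generalizing V s with
  | zero =>
    rw [Finset.card_eq_zero] at hk
    subst hk
    simpa [revealWeight] using condEntropy_nonneg (uniformLibrary N B) Q (readBits s)
  | succ k ih =>
    set H := condEntropy (uniformLibrary N B) Q (readBits s)
    set L := ∑ n ∈ V, decodingLoss Q (c n) n
    have hfirst : ∀ m ∈ V, ∑ b, ((if b ∈ file m \ (s ∪ c m) then 1 else 0)
        + revealWeight c (V.erase m) (file m ∪ (s ∪ c m)) b) ≤ H + L := by
      intro m hm
      have hreveal := condEntropy_readBits_reveal_le Q s (c m) m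
      have hih := ih (V.erase m) (file m ∪ (s ∪ c m)) (by
        rw [Finset.card_erase_of_mem hm, hk, Nat.add_sub_cancel])
      have hsplit : decodingLoss Q (c m) m + ∑ n ∈ V.erase m, decodingLoss Q (c n) n = L :=
        Finset.add_sum_erase V (fun n => decodingLoss Q (c n) n) hm
      have hcard : ∑ b, (if b ∈ file m \ (s ∪ c m) then (1 : ℝ) else 0)
          = (file m \ (s ∪ c m)).card := by
        rw [Finset.sum_ite_mem, Finset.univ_inter, Finset.sum_const, nsmul_one]
      rw [Finset.sum_add_distrib, hcard]
      linarith
    have hpos : (0 : ℝ) < V.card := by rw [hk]; positivity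
    have havg : ∑ b, revealWeight c V s b ≤ H + L := by
      refine le_of_mul_le_mul_left ?_ hpos
      calc (V.card : ℝ) * ∑ b, revealWeight c V s b
          ≤ ∑ b, ∑ m ∈ V, ((if b ∈ file m \ (s ∪ c m) then 1 else 0)
            + revealWeight c (V.erase m) (file m ∪ (s ∪ c m)) b) := by
            rw [Finset.mul_sum]
            exact Finset.sum_le_sum fun b _ => card_mul_revealWeight_le c V s b
        _ = ∑ m ∈ V, ∑ b, ((if b ∈ file m \ (s ∪ c m) then 1 else 0)
            + revealWeight c (V.erase m) (file m ∪ (s ∪ c m)) b) := Finset.sum_comm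
        _ ≤ ∑ _m ∈ V, (H + L) := Finset.sum_le_sum hfirst
        _ = V.card * (H + L) := by rw [Finset.sum_const, nsmul_eq_mul]
    linarith

lemma sub_mul_card_le_sum_revealWeight {A C : ℝ}
    (hAC : ∀ t : ℕ, t < N → A - C * t ≤ 1 / ((t : ℝ) + 1)) (n : Fin N) :
    A * ((file n \ c n).card : ℝ) - C * ∑ l, (((file n \ c n) ∩ c l).card : ℝ)
      ≤ ∑ b ∈ file n, revealWeight c Finset.univ ∅ b := by
  have hcount : ∑ l, (((file n \ c n) ∩ c l).card : ℝ)
      = ∑ b ∈ file n \ c n, ((Finset.univ.filter fun l => b ∈ c l).card : ℝ) := by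
    simp only [← Finset.filter_mem_eq_inter, Finset.card_filter, Nat.cast_sum]
    exact Finset.sum_comm
  have hweight : ∀ b ∈ file n \ c n, A - C * ((Finset.univ.filter fun l => b ∈ c l).card : ℝ)
      ≤ revealWeight c Finset.univ ∅ b := by
    intro b hb
    obtain ⟨rfl, hbc⟩ := (by simpa using hb : b.1 = n ∧ b ∉ c n)
    rw [revealWeight, if_pos ⟨Finset.mem_univ _, Finset.notMem_empty _, hbc⟩]
    exact hAC _ ((Finset.card_lt_univ_of_notMem (x := b.1) (by simpa using hbc)).trans_eq
      (Fintype.card_fin N))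
  calc A * ((file n \ c n).card : ℝ) - C * ∑ l, (((file n \ c n) ∩ c l).card : ℝ)
      = ∑ b ∈ file n \ c n, (A - C * ((Finset.univ.filter fun l => b ∈ c l).card : ℝ)) := by
        rw [Finset.sum_sub_distrib, Finset.sum_const, nsmul_eq_mul, ← Finset.mul_sum, hcount,
          mul_comm A]
    _ ≤ ∑ b ∈ file n \ c n, revealWeight c Finset.univ ∅ b := Finset.sum_le_sum hweight
    _ ≤ ∑ b ∈ file n, revealWeight c Finset.univ ∅ b :=
        Finset.sum_le_sum_of_subset_of_nonneg Finset.sdiff_subset fun b _ _ =>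
          revealWeight_nonneg ..

lemma sub_sum_decodingLoss_le_entropy {A C : ℝ}
    (hAC : ∀ t : ℕ, t < N → A - C * t ≤ 1 / ((t : ℝ) + 1)) (Q : Library N B → α) :
    A * ∑ n, ((file n \ c n).card : ℝ) - C * ∑ n, ∑ l, (((file n \ c n) ∩ c l).card : ℝ)
      - ∑ n, decodingLoss Q (c n) n ≤ entropy (uniformLibrary N B) Q := by
  have hfiles : ∑ n, ∑ b ∈ file n, revealWeight c Finset.univ ∅ b
      = ∑ b, revealWeight c Finset.univ ∅ b := by
    simp only [file, Finset.sum_product, Finset.sum_singleton, ← Fintype.sum_prod_type]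
  calc A * ∑ n, ((file n \ c n).card : ℝ) - C * ∑ n, ∑ l, (((file n \ c n) ∩ c l).card : ℝ)
        - ∑ n, decodingLoss Q (c n) n
      ≤ ∑ b, revealWeight c Finset.univ ∅ b - ∑ n, decodingLoss Q (c n) n := by
        rw [← hfiles, Finset.mul_sum, Finset.mul_sum, ← Finset.sum_sub_distrib]
        exact sub_le_sub_right (Finset.sum_le_sum fun n _ =>
          sub_mul_card_le_sum_revealWeight c hAC n) _
    _ ≤ condEntropy (uniformLibrary N B) Q (readBits ∅) :=
        sum_revealWeight_sub_le_condEntropy c Finset.univ ∅ Q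
    _ ≤ entropy (uniformLibrary N B) Q := condEntropy_le_entropy ..

end Reveal

section TwoPackets

variable {N B : ℕ} {α : Fin 2 → Type} [∀ k, Fintype (α k)]

lemma sum_card_file_inter (s : Finset (Fin N × Fin B)) :
    ∑ n, ((file n ∩ s).card : ℝ) = s.card := by
  have hfiber (n : Fin N) : file n ∩ s = s.filter fun b => b.1 = n := by
    ext b
    simp [and_comm]
  simp only [hfiber]
  exact_mod_cast (Finset.card_eq_sum_card_fiberwise (s := s) (f := Prod.fst) (t := Finset.univ)
    fun _ _ => Finset.mem_coe.2 (Finset.mem_univ _)).symm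

lemma sum_card_file_sdiff (s : Finset (Fin N × Fin B)) :
    ∑ n, ((file n \ s).card : ℝ) = N * B - s.card := by
  have hcard (n : Fin N) : ((file n \ s).card : ℝ) = B - (file n ∩ s).card := by
    rw [eq_sub_iff_add_eq']
    exact_mod_cast (Finset.card_inter_add_card_sdiff (file n) s).trans (card_file n)
  simp only [hcard, Finset.sum_sub_distrib, sum_card_file_inter, Finset.sum_const,
    Finset.card_univ, Fintype.card_fin, nsmul_eq_mul]

lemma card_sdiff_inter_add_card_sdiff_inter_le {β : Type*} [DecidableEq β]
    (f a a' b b' : Finset β) :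
    ((f \ a) ∩ a').card + ((f \ b) ∩ b').card
      ≤ (f ∩ (a' ∩ b')).card + (f \ (b ∪ a')).card + (f \ (b ∪ a)).card + (f \ (a ∪ b')).card := by
  have hb : ((f \ b) ∩ b').card
      ≤ ((f ∩ (a' ∩ b')) ∩ a).card + (f \ (b ∪ a')).card + (f \ (b ∪ a)).card := by
    refine (Finset.card_le_card (t := (((f ∩ (a' ∩ b')) ∩ a) ∪ (f \ (b ∪ a'))) ∪ (f \ (b ∪ a)))
      fun x => ?_).trans ((Finset.card_union_le _ _).trans
        (Nat.add_le_add_right (Finset.card_union_le _ _) _))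
    simp only [Finset.mem_union, Finset.mem_inter, Finset.mem_sdiff]
    tauto
  have ha : ((f \ a) ∩ a').card ≤ ((f ∩ (a' ∩ b')) \ a).card + (f \ (a ∪ b')).card := by
    refine (Finset.card_le_card (t := ((f ∩ (a' ∩ b')) \ a) ∪ (f \ (a ∪ b')))
      fun x => ?_).trans (Finset.card_union_le _ _)
    simp only [Finset.mem_union, Finset.mem_inter, Finset.mem_sdiff]
    tauto
  have hsplit := Finset.card_inter_add_card_sdiff (f ∩ (a' ∩ b')) a
  omega

lemma decodingLoss_le_decodingLoss_pair (P : (k : Fin 2) → Library N B → α k)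
    {s : Finset (Fin N × Fin B)} {j k : Fin 2} (hjk : j ≠ k)
    (hs : condEntropy (uniformLibrary N B) (P k) (readBits s) = 0) (n : Fin N) :
    decodingLoss (P j) s n ≤ decodingLoss (fun F i => P i F) s n := by
  have hown : condEntropy (uniformLibrary N B) (P k) (fun F => (P j F, readBits s F)) ≤ 0 :=
    hs ▸ condEntropy_prodMk_le ..
  have hboth : condEntropy (uniformLibrary N B) (fun F => F n)
      (fun F => (P k F, P j F, readBits s F)) ≤ decodingLoss (fun F i => P i F) s n := by
    refine condEntropy_le_of_factorsThrough _ _ fun F F' he => ?_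
    simp only [Prod.mk.injEq] at he ⊢
    refine ⟨funext fun i => ?_, he.2.2⟩
    obtain rfl | rfl : i = k ∨ i = j := by omega
    exacts [he.1, he.2.1]
  linarith [condEntropy_le_add (uniformLibrary N B) (fun F => F n) (P k)
    (fun F => (P j F, readBits s F)), decodingLoss.eq_def (P j) s n]

lemma card_file_sdiff_union_le_decodingLoss_pair (P : (k : Fin 2) → Library N B → α k)
    {s t : Finset (Fin N × Fin B)} {j k : Fin 2} (hjk : j ≠ k)
    (hs : condEntropy (uniformLibrary N B) (P k) (readBits s) = 0)
    (ht : condEntropy (uniformLibrary N B) (P j) (readBits t) = 0) (n : Fin N) :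
    ((file n \ (s ∪ t)).card : ℝ) ≤ decodingLoss (fun F i => P i F) s n :=
  (card_file_sdiff_union_le_decodingLoss ht s n).trans
    (decodingLoss_le_decodingLoss_pair P hjk hs n)

/-- What the two users with caches `s 0` and `s 1`, when they both demand file `n`, cannot infer
about it from their caches and the two packets: the sum over the users, in bits. -/
noncomputable def totalLoss (P : (k : Fin 2) → Library N B → α k)
    (s : Fin 2 → Finset (Fin N × Fin B)) (n : Fin N) : ℝ :=
  ∑ k, decodingLoss (fun F i => P i F) (s k) n

/-- The lower bound on the load contributed by the caches `s 0` and `s 1` of two users that both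
demand file `l`: the bits of file `l` that have to be delivered count with weight `A`, the bits of
the other files that both users store with weight `-C`. -/
noncomputable def cacheGain (A C : ℝ) (s : Fin 2 → Finset (Fin N × Fin B)) (l : Fin N) : ℝ :=
  A * (((file l \ s 0).card : ℝ) + (file l \ s 1).card)
    - C * ∑ n ∈ Finset.univ.erase l, ((file n ∩ (s 0 ∩ s 1)).card : ℝ)

lemma sum_cacheGain (A C : ℝ) (s : Fin 2 → Finset (Fin N × Fin B)) :
    ∑ l, cacheGain A C s l
      = A * (2 * (N * B) - (s 0).card - (s 1).card) - C * ((N - 1) * (s 0 ∩ s 1).card) := by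
  have herase (l : Fin N) : ∑ n ∈ Finset.univ.erase l, ((file n ∩ (s 0 ∩ s 1)).card : ℝ)
      = (s 0 ∩ s 1).card - (file l ∩ (s 0 ∩ s 1)).card := by
    rw [← sum_card_file_inter (s 0 ∩ s 1), ← Finset.sum_erase_add _ _ (Finset.mem_univ l),
      add_sub_cancel_right]
  simp only [cacheGain, herase, Finset.sum_sub_distrib, Finset.sum_add_distrib, ← Finset.mul_sum,
    sum_card_file_sdiff, sum_card_file_inter, Finset.sum_const, Finset.card_univ, Fintype.card_fin,
    nsmul_eq_mul]
  ring

section Selection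

variable {P : (k : Fin 2) → Library N B → α k} {c : Fin N → Fin 2 → Finset (Fin N × Fin B)}

lemma sub_sum_decodingLoss_pair_le_entropy {A C : ℝ}
    (hAC : ∀ t : ℕ, t < N → A - C * t ≤ 1 / ((t : ℝ) + 1)) {j k : Fin 2} (hjk : j ≠ k)
    (hc : ∀ l, condEntropy (uniformLibrary N B) (P k) (readBits (c l k)) = 0) :
    A * ∑ n, ((file n \ c n k).card : ℝ) - C * ∑ n, ∑ l, (((file n \ c n k) ∩ c l k).card : ℝ)
      - ∑ n, decodingLoss (fun F i => P i F) (c n k) n ≤ entropy (uniformLibrary N B) (P j) := by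
  have hloss := Finset.sum_le_sum fun n (_ : n ∈ Finset.univ) =>
    decodingLoss_le_decodingLoss_pair P hjk (hc n) n
  linarith [sub_sum_decodingLoss_le_entropy (fun n => c n k) hAC (P j)]

lemma card_sdiff_inter_pair_le
    (hc : ∀ l k, condEntropy (uniformLibrary N B) (P k) (readBits (c l k)) = 0) (n l : Fin N) :
    (((file n \ c n 0) ∩ c l 0).card : ℝ) + ((file n \ c n 1) ∩ c l 1).card
      ≤ (if n = l then 0 else ((file n ∩ (c l 0 ∩ c l 1)).card : ℝ)) + 3 * totalLoss P (c n) n := by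
  have hloss (k : Fin 2) := decodingLoss_nonneg (fun F i => P i F) (c n k) n
  rw [totalLoss, Fin.sum_univ_two]
  split_ifs with hnl
  · subst hnl
    simp only [Finset.sdiff_inter_self, Finset.card_empty, Nat.cast_zero]
    linarith [hloss 0, hloss 1]
  · have hcover (j k : Fin 2) (hjk : j ≠ k) (m : Fin N) :=
      card_file_sdiff_union_le_decodingLoss_pair P hjk (hc n k) (hc m j) n
    have hcard : (((file n \ c n 0) ∩ c l 0).card : ℝ) + ((file n \ c n 1) ∩ c l 1).card
        ≤ (file n ∩ (c l 0 ∩ c l 1)).card + (file n \ (c n 1 ∪ c l 0)).card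
          + (file n \ (c n 1 ∪ c n 0)).card + (file n \ (c n 0 ∪ c l 1)).card := by
      exact_mod_cast card_sdiff_inter_add_card_sdiff_inter_le ..
    linarith [hcover 0 1 (by decide) l, hcover 0 1 (by decide) n, hcover 1 0 (by decide) l,
      hloss 0, hloss 1]

lemma sum_card_sdiff_inter_pair_le
    (hc : ∀ l k, condEntropy (uniformLibrary N B) (P k) (readBits (c l k)) = 0) :
    ∑ n, ∑ l, (((file n \ c n 0) ∩ c l 0).card : ℝ)
        + ∑ n, ∑ l, (((file n \ c n 1) ∩ c l 1).card : ℝ)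
      ≤ ∑ l, ∑ n ∈ Finset.univ.erase l, ((file n ∩ (c l 0 ∩ c l 1)).card : ℝ)
        + 3 * N * ∑ n, totalLoss P (c n) n := by
  have hdiag (l : Fin N) :
      ∑ n, (if n = l then 0 else ((file n ∩ (c l 0 ∩ c l 1)).card : ℝ))
        = ∑ n ∈ Finset.univ.erase l, ((file n ∩ (c l 0 ∩ c l 1)).card : ℝ) := by
    rw [← Finset.sum_erase_add _ _ (Finset.mem_univ l), if_pos rfl, add_zero]
    exact Finset.sum_congr rfl fun n hn => if_neg (Finset.ne_of_mem_erase hn)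
  have hsum := Finset.sum_le_sum fun n (_ : n ∈ Finset.univ) =>
    Finset.sum_le_sum fun l (_ : l ∈ Finset.univ) => card_sdiff_inter_pair_le hc n l
  simp only [Finset.sum_add_distrib, Finset.sum_const, Finset.card_univ, Fintype.card_fin,
    nsmul_eq_mul, ← Finset.mul_sum] at hsum
  rw [Finset.sum_comm (f := fun n l => if n = l then 0 else _)] at hsum
  simp only [hdiag] at hsum
  linarith

lemma sum_cacheGain_sub_totalLoss_le {A C : ℝ} (hC : 0 ≤ C)
    (hAC : ∀ t : ℕ, t < N → A - C * t ≤ 1 / ((t : ℝ) + 1))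
    (hc : ∀ l k, condEntropy (uniformLibrary N B) (P k) (readBits (c l k)) = 0) :
    ∑ l, (cacheGain A C (c l) l - (1 + 3 * C * N) * totalLoss P (c l) l)
      ≤ ∑ k, entropy (uniformLibrary N B) (P k) := by
  have hpair := mul_le_mul_of_nonneg_left (sum_card_sdiff_inter_pair_le hc) hC
  have hfirst := sub_sum_decodingLoss_pair_le_entropy hAC (j := 0) (k := 1) (by decide)
    fun l => hc l 1
  have hsecond := sub_sum_decodingLoss_pair_le_entropy hAC (j := 1) (k := 0) (by decide)
    fun l => hc l 0
  have hloss : ∑ n, totalLoss P (c n) n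
      = ∑ n, decodingLoss (fun F i => P i F) (c n 0) n
        + ∑ n, decodingLoss (fun F i => P i F) (c n 1) n := by
    simp only [totalLoss, Fin.sum_univ_two, Finset.sum_add_distrib]
  simp only [cacheGain, Fin.sum_univ_two, Finset.sum_sub_distrib, Finset.sum_add_distrib,
    ← Finset.mul_sum]
  rw [hloss] at hpair ⊢
  linarith

end Selection

end TwoPackets

/-- The factor by which the decoding slack grows when one conditions, for each file in turn, on
both users demanding that file. -/
noncomputable def conditioningCost {N : ℕ} (demandLaw : PMF (Fin 2 → Fin N)) : ℝ :=
  ∑ n : Fin N, (demandLaw fun _ => n).toReal⁻¹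

namespace Scheme

section Works

variable {K N B : ℕ} (S : Scheme K N B) (demandLaw : PMF (Fin K → Fin N))

/-- The joint law of the cache metadata and the packet metadata given the demands `d`. -/
noncomputable def metaLaw (d : Fin K → Fin N) :
    PMF (((k : Fin K) → S.CacheMeta k) × ((k : Fin K) → S.PacketMeta k)) :=
  joint S.placement (S.server d)

/-- The part of an outcome that does not involve the library: the demands and all metadata. -/
def metadata (ω : S.Outcome) :
    (Fin K → Fin N) × ((k : Fin K) → S.CacheMeta k) × ((k : Fin K) → S.PacketMeta k) :=
  (ω.1, ω.2.1, ω.2.2.1)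

lemma law_eq_map : S.law demandLaw
    = (joint (joint demandLaw S.metaLaw) fun _ => uniformLibrary N B).map
      fun x => (x.1.1, x.1.2.1, x.1.2.2, x.2) := by
  simp only [law, metaLaw, joint, PMF.map_bind, PMF.bind_bind, PMF.bind_map, PMF.map_comp,
    Function.comp_def]
  rfl

lemma cache_eq_iff {k : Fin K} {ω ω' : S.Outcome} : S.cache k ω = S.cache k ω' ↔
    S.cacheMeta k ω = S.cacheMeta k ω' ∧
      readBits (S.stored k (S.cacheMeta k ω)) (S.library ω)
        = readBits (S.stored k (S.cacheMeta k ω')) (S.library ω') := Prod.mk_inj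

lemma signals_eq_iff {ω ω' : S.Outcome} : S.signals ω = S.signals ω' ↔
    (S.metadata ω).2.2 = (S.metadata ω').2.2 ∧
      (fun k => S.compose k (S.packetMeta k ω) (S.library ω))
        = fun k => S.compose k (S.packetMeta k ω') (S.library ω') := by
  simp only [funext_iff, ← forall_and]
  exact forall_congr' fun k => Prod.mk_inj

lemma map_metadata_law : (S.law demandLaw).map S.metadata = joint demandLaw S.metaLaw := by
  rw [law_eq_map, PMF.map_comp]
  exact map_fst_joint _ _

variable {β γ δ : Type} [Fintype β] [Fintype γ] [Fintype δ]
  (m : (Fin K → Fin N) × ((k : Fin K) → S.CacheMeta k) × ((k : Fin K) → S.PacketMeta k) → γ)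

lemma entropy_law (g : γ → Library N B → δ) :
    entropy (S.law demandLaw) (fun ω => (m (S.metadata ω), g (m (S.metadata ω)) (S.library ω)))
      = entropy (joint demandLaw S.metaLaw) m
        + mean (joint demandLaw S.metaLaw) fun a => entropy (uniformLibrary N B) (g (m a)) := by
  rw [law_eq_map, entropy_map]
  exact entropy_joint _ m (fun _ => uniformLibrary N B) g

lemma condEntropy_law (f : γ → Library N B → β) (g : γ → Library N B → δ) :
    condEntropy (S.law demandLaw) (fun ω => f (m (S.metadata ω)) (S.library ω))
        (fun ω => (m (S.metadata ω), g (m (S.metadata ω)) (S.library ω)))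
      = mean (joint demandLaw S.metaLaw) fun a =>
        condEntropy (uniformLibrary N B) (f (m a)) (g (m a)) := by
  rw [law_eq_map, condEntropy_map]
  exact condEntropy_joint _ m (fun _ => uniformLibrary N B) f g

variable {S demandLaw} {M R ε : ℝ}

lemma Works.mean_card_stored_le (h : S.Works demandLaw M R ε) (k : Fin K) :
    mean S.placement (fun c => ((S.stored k (c k)).card : ℝ)) ≤ B * (M + ε) := by
  have hentropy : entropy (S.law demandLaw) (S.cache k)
      = entropy (joint demandLaw S.metaLaw) (fun a => a.2.1 k)
        + mean (joint demandLaw S.metaLaw) fun a => ((S.stored k (a.2.1 k)).card : ℝ) := by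
    simp only [← entropy_readBits]
    exact S.entropy_law demandLaw (fun a => a.2.1 k) fun c => readBits (S.stored k c)
  have hmean : mean (joint demandLaw S.metaLaw) (fun a => ((S.stored k (a.2.1 k)).card : ℝ))
      = mean S.placement fun c => ((S.stored k (c k)).card : ℝ) := by
    rw [mean_joint]
    simp only [metaLaw, mean_comp_fst_joint S.placement _ fun c => ((S.stored k (c k)).card : ℝ),
      mean_const]
  linarith [h.cache_size k, entropy_nonneg (joint demandLaw S.metaLaw) fun a => a.2.1 k]

lemma Works.sum_mean_entropy_compose_le (h : S.Works demandLaw M R ε) :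
    ∑ k, mean (joint demandLaw S.metaLaw)
        (fun a => entropy (uniformLibrary N B) (S.compose k (a.2.2 k))) ≤ B * (R + ε) := by
  refine le_trans (Finset.sum_le_sum fun k _ => ?_) h.load
  calc mean (joint demandLaw S.metaLaw)
        (fun a => entropy (uniformLibrary N B) (S.compose k (a.2.2 k)))
      ≤ entropy (joint demandLaw S.metaLaw) (fun a => a.2.2 k)
        + mean (joint demandLaw S.metaLaw)
          (fun a => entropy (uniformLibrary N B) (S.compose k (a.2.2 k))) :=
        le_add_of_nonneg_left (entropy_nonneg _ _)
    _ = entropy (S.law demandLaw) (S.signal k) :=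
        (S.entropy_law demandLaw (fun a => a.2.2 k) (S.compose k)).symm

lemma Works.condEntropy_compose_eq_zero (h : S.Works demandLaw M R ε) {d : Fin K → Fin N}
    (hd : demandLaw d ≠ 0) {x : ((k : Fin K) → S.CacheMeta k) × ((k : Fin K) → S.PacketMeta k)}
    (hx : x ∈ (S.metaLaw d).support) (k : Fin K) :
    condEntropy (uniformLibrary N B) (S.compose k (x.2 k)) (readBits (S.stored k (x.1 k))) = 0 := by
  have hmean : mean (joint demandLaw S.metaLaw) (fun a => condEntropy (uniformLibrary N B)
      (S.compose k (a.2.2 k)) (readBits (S.stored k (a.2.1 k)))) = 0 := by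
    rw [← h.encoding k]
    refine (S.condEntropy_law demandLaw (fun a => (a.2.2 k, a.2.1 k)) (fun a => S.compose k a.1)
      fun a => readBits (S.stored k a.2)).symm.trans
        (condEntropy_congr _ (fun ω ω' => ?_) fun ω ω' he => ?_)
    · rw [Prod.mk_inj, Prod.mk_inj, Prod.mk_inj, and_assoc, cache_eq_iff]
      rfl
    · have hp : S.packetMeta k ω = S.packetMeta k ω' := (Prod.mk.inj (Prod.mk.inj he).1).1
      exact (Prod.mk_inj.trans (and_iff_right hp)).symm
  have hdx : (d, x) ∈ (joint demandLaw S.metaLaw).support := mem_support_joint.2 ⟨hd, hx⟩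
  have hzero := eq_zero_of_mean_eq_zero (fun _ => condEntropy_nonneg _ _ _) hmean hdx
  exact hzero

lemma Works.mean_decodingLoss_le (h : S.Works demandLaw M R ε) {d : Fin K → Fin N}
    (hd : demandLaw d ≠ 0) (k : Fin K) :
    mean (S.metaLaw d) (fun x => decodingLoss (fun F j => S.compose j (x.2 j) F)
      (S.stored k (x.1 k)) (d k)) ≤ B * ε / (demandLaw d).toReal := by
  rw [le_div_iff₀' (ENNReal.toReal_pos hd (demandLaw.apply_ne_top d))]
  calc (demandLaw d).toReal * mean (S.metaLaw d) (fun x =>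
        decodingLoss (fun F j => S.compose j (x.2 j) F) (S.stored k (x.1 k)) (d k))
      ≤ mean (joint demandLaw S.metaLaw) (fun a =>
        decodingLoss (fun F j => S.compose j (a.2.2 j) F) (S.stored k (a.2.1 k)) (a.1 k)) := by
        rw [mean_joint]
        exact toReal_mul_le_mean demandLaw (f := fun d => mean (S.metaLaw d) fun x =>
          decodingLoss (fun F j => S.compose j (x.2 j) F) (S.stored k (x.1 k)) (d k))
          (fun d => mean_nonneg fun x => decodingLoss_nonneg _ _ _) d
    _ = condEntropy (S.law demandLaw) (S.demandedFile k)
        (fun ω => (S.signals ω, S.cache k ω, S.demands ω k)) := by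
        refine (S.condEntropy_law demandLaw (fun a => (a.2.2, a.2.1 k, a.1 k))
          (fun a F => F a.2.2) fun a F =>
            ((fun j => S.compose j (a.1 j) F), readBits (S.stored k a.2.1) F)).symm.trans
          (condEntropy_congr _ (fun ω ω' => ?_) fun _ _ _ => Iff.rfl)
        simp only [Prod.mk_inj, signals_eq_iff, cache_eq_iff]
        tauto
    _ ≤ B * ε := h.decoding k

lemma prob_demands_packetMeta (d : Fin K → Fin N) (p : (k : Fin K) → S.PacketMeta k) :
    prob (S.law demandLaw) (fun ω => (S.demands ω, (S.metadata ω).2.2)) (d, p)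
      = (demandLaw d).toReal * (((S.metaLaw d).map Prod.snd) p).toReal := by
  have hmap : (S.law demandLaw).map (fun ω => (S.demands ω, (S.metadata ω).2.2))
      = joint demandLaw fun d => (S.metaLaw d).map Prod.snd := by
    calc (S.law demandLaw).map (fun ω => (S.demands ω, (S.metadata ω).2.2))
        = (joint demandLaw S.metaLaw).map fun x => (x.1, x.2.2) := by
          rw [← map_metadata_law, PMF.map_comp]
          rfl
      _ = joint demandLaw fun d => (S.metaLaw d).map Prod.snd :=
          (map_joint_comp demandLaw id S.metaLaw fun _ => Prod.snd).trans (by rw [PMF.map_id])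
  rw [prob, hmap, joint_apply, ENNReal.toReal_mul]

lemma prob_demands (d : Fin K → Fin N) :
    prob (S.law demandLaw) S.demands d = (demandLaw d).toReal := by
  have hmap : (S.law demandLaw).map S.demands = demandLaw := by
    calc (S.law demandLaw).map S.demands = (joint demandLaw S.metaLaw).map Prod.fst := by
          rw [← map_metadata_law, PMF.map_comp]
          rfl
      _ = demandLaw := map_fst_joint _ _
  rw [prob, hmap]

lemma Works.map_snd_metaLaw_congr (h : S.Works demandLaw M R ε) {d d' : Fin K → Fin N}
    (hd : demandLaw d ≠ 0) (hd' : demandLaw d' ≠ 0) {k : Fin K} (hk : d k = d' k) :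
    (S.metaLaw d).map Prod.snd = (S.metaLaw d').map Prod.snd := by
  have hfactors : (fun ω => (S.metadata ω).2.2).FactorsThrough
      fun ω => (S.signals ω, S.cache k ω) :=
    fun _ _ he => (S.signals_eq_iff.1 (Prod.mk.inj he).1).1
  have hprivacy : condMutualInfo (S.law demandLaw) S.demands (fun ω => (S.metadata ω).2.2)
      (fun ω => S.demands ω k) = 0 :=
    condMutualInfo_eq_zero_of_factorsThrough _ hfactors (h.privacy k)
  have hne {e : Fin K → Fin N} (he : demandLaw e ≠ 0) : (demandLaw e).toReal ≠ 0 :=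
    (ENNReal.toReal_pos he (demandLaw.apply_ne_top e)).ne'
  ext p
  have hp := prob_mul_prob_comm_of_condMutualInfo_eq_zero (X := S.demands) (g := fun d => d k)
    hprivacy hk p
  rw [prob_demands_packetMeta, prob_demands_packetMeta, prob_demands, prob_demands] at hp
  have hcancel : (((S.metaLaw d).map Prod.snd) p).toReal
      = (((S.metaLaw d').map Prod.snd) p).toReal := by
    refine mul_left_cancel₀ (mul_ne_zero (hne hd) (hne hd')) ?_
    linear_combination hp
  exact (ENNReal.toReal_eq_toReal_iff' (PMF.apply_ne_top _ _) (PMF.apply_ne_top _ _)).1 hcancel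

end Works

section TwoUsers

variable {N B : ℕ} (S : Scheme 2 N B) {demandLaw : PMF (Fin 2 → Fin N)} {M R ε : ℝ}

/-- The positions of the bits stored by the two users with cache metadata `c`. -/
abbrev caches (c : (k : Fin 2) → S.CacheMeta k) (k : Fin 2) : Finset (Fin N × Fin B) :=
  S.stored k (c k)

/-- The packets of the two users with packet metadata `p`, as functions of the library. -/
abbrev packets (p : (k : Fin 2) → S.PacketMeta k) (k : Fin 2) : Library N B → S.Packet k :=
  S.compose k (p k)

variable {S}

lemma Works.map_snd_metaLaw_eq (hD : ∀ d, demandLaw d ≠ 0) (h : S.Works demandLaw M R ε)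
    (d d' : Fin 2 → Fin N) : (S.metaLaw d).map Prod.snd = (S.metaLaw d').map Prod.snd :=
  (h.map_snd_metaLaw_congr (hD d) (hD ![d 0, d' 1]) (k := 0) rfl).trans
    (h.map_snd_metaLaw_congr (hD ![d 0, d' 1]) (hD d') (k := 1) rfl)

lemma Works.mean_sum_entropy_packets_le (hD : ∀ d, demandLaw d ≠ 0) (h : S.Works demandLaw M R ε)
    (d : Fin 2 → Fin N) :
    mean ((S.metaLaw d).map Prod.snd)
        (fun p => ∑ k, entropy (uniformLibrary N B) (S.packets p k)) ≤ B * (R + ε) := by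
  refine le_trans (le_of_eq ?_) h.sum_mean_entropy_compose_le
  rw [mean_sum]
  refine Finset.sum_congr rfl fun k _ => ?_
  have hsame (e : Fin 2 → Fin N) :
      mean (S.metaLaw e) (fun x => entropy (uniformLibrary N B) (S.compose k (x.2 k)))
        = mean ((S.metaLaw d).map Prod.snd)
          fun p => entropy (uniformLibrary N B) (S.compose k (p k)) := by
    rw [h.map_snd_metaLaw_eq hD d e, mean_map]
  rw [mean_joint]
  simp only [hsame, mean_const]

lemma Works.sum_mean_decodingLoss_le (hD : ∀ d, demandLaw d ≠ 0) (h : S.Works demandLaw M R ε)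
    (k : Fin 2) :
    ∑ n, mean (S.metaLaw fun _ => n)
        (fun x => decodingLoss (fun F j => S.packets x.2 j F) (S.caches x.1 k) n)
      ≤ B * ε * conditioningCost demandLaw := by
  rw [conditioningCost, Finset.mul_sum]
  exact Finset.sum_le_sum fun n _ => h.mean_decodingLoss_le (hD fun _ => n) k

lemma Works.sum_mean_totalLoss_le (hD : ∀ d, demandLaw d ≠ 0) (h : S.Works demandLaw M R ε) :
    ∑ n, mean (S.metaLaw fun _ => n) (fun x => totalLoss (S.packets x.2) (S.caches x.1) n)
      ≤ 2 * (B * ε * conditioningCost demandLaw) := by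
  simp only [totalLoss, mean_sum]
  rw [Finset.sum_comm, Fin.sum_univ_two, two_mul]
  exact add_le_add (h.sum_mean_decodingLoss_le hD 0) (h.sum_mean_decodingLoss_le hD 1)

lemma Works.mean_uncovered_le (hD : ∀ d, demandLaw d ≠ 0) (h : S.Works demandLaw M R ε) :
    mean S.placement (fun c => N * B - ((S.caches c 0).card : ℝ) - (S.caches c 1).card
        + (S.caches c 0 ∩ S.caches c 1).card)
      ≤ B * ε * conditioningCost demandLaw := by
  have huncovered (c : (k : Fin 2) → S.CacheMeta k) :
      N * B - ((S.caches c 0).card : ℝ) - (S.caches c 1).card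
        + (S.caches c 0 ∩ S.caches c 1).card
        = ∑ n, ((file n \ (S.caches c 0 ∪ S.caches c 1)).card : ℝ) := by
    have hunion : ((S.caches c 0 ∪ S.caches c 1).card : ℝ) + (S.caches c 0 ∩ S.caches c 1).card
        = (S.caches c 0).card + (S.caches c 1).card :=
      mod_cast Finset.card_union_add_card_inter (S.caches c 0) (S.caches c 1)
    rw [sum_card_file_sdiff]
    linarith
  simp only [huncovered, mean_sum]
  refine le_trans (Finset.sum_le_sum fun n _ => ?_) (h.sum_mean_decodingLoss_le hD 0)
  rw [← mean_comp_fst_joint S.placement (S.server fun _ => n)]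
  refine mean_le_mean fun x hx => ?_
  have hcompose := h.condEntropy_compose_eq_zero (hD fun _ => n) hx
  exact card_file_sdiff_union_le_decodingLoss_pair (S.packets x.2) (j := 1) (k := 0) (by decide)
    (hcompose 0) (hcompose 1) n

lemma Works.mean_sum_cacheGain_le (hD : ∀ d, demandLaw d ≠ 0) (h : S.Works demandLaw M R ε)
    (hN : 1 ≤ N) {A C : ℝ} (hC : 0 ≤ C)
    (hAC : ∀ t : ℕ, t < N → A - C * t ≤ 1 / ((t : ℝ) + 1)) :
    mean S.placement (fun c => ∑ l, cacheGain A C (S.caches c) l)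
      ≤ B * (R + ε) + (1 + 3 * C * N) * (2 * (B * ε * conditioningCost demandLaw)) := by
  have hselect : ∑ l, mean (S.metaLaw fun _ => l) (fun x => cacheGain A C (S.caches x.1) l
      - (1 + 3 * C * N) * totalLoss (S.packets x.2) (S.caches x.1) l) ≤ B * (R + ε) := by
    refine (sum_mean_le_mean_of_forall_selection (Q := fun l => S.metaLaw fun _ => l)
      (H := fun p => ∑ k, entropy (uniformLibrary N B) (S.packets p k))
      (fun l => h.map_snd_metaLaw_eq hD (fun _ => l) fun _ => ⟨0, hN⟩) fun p c hc => ?_).trans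
        (h.mean_sum_entropy_packets_le hD _)
    have hcompose (l : Fin N) (k : Fin 2) :
        condEntropy (uniformLibrary N B) (S.packets p k) (readBits (S.caches (c l) k)) = 0 :=
      h.condEntropy_compose_eq_zero (x := (c l, p)) (hD fun _ => l) (hc l) k
    exact sum_cacheGain_sub_totalLoss_le (P := S.packets p) (c := fun l => S.caches (c l)) hC hAC
      hcompose
  have hplacement (l : Fin N) : mean (S.metaLaw fun _ => l)
      (fun x => cacheGain A C (S.caches x.1) l)
        = mean S.placement fun c => cacheGain A C (S.caches c) l :=
    mean_comp_fst_joint S.placement (S.server fun _ => l) fun c => cacheGain A C (S.caches c) l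
  have hloss := mul_le_mul_of_nonneg_left (h.sum_mean_totalLoss_le hD)
    (show 0 ≤ 1 + 3 * C * N by positivity)
  simp only [mean_sub, mean_const_mul, hplacement, Finset.sum_sub_distrib, ← Finset.mul_sum]
    at hselect
  rw [mean_sum]
  linarith

lemma Works.le_load (hD : ∀ d, demandLaw d ≠ 0) (h : S.Works demandLaw M R ε) (hN : 1 ≤ N)
    {A C : ℝ} (hA : 0 ≤ A) (hC : 0 ≤ C)
    (hAC : ∀ t : ℕ, t < N → A - C * t ≤ 1 / ((t : ℝ) + 1)) :
    A * (2 * (N * B) - 2 * (B * (M + ε)))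
        - C * ((N - 1) * (2 * (B * (M + ε)) - N * B + B * ε * conditioningCost demandLaw))
      ≤ B * (R + ε) + (1 + 3 * C * N) * (2 * (B * ε * conditioningCost demandLaw)) := by
  refine le_trans ?_ (h.mean_sum_cacheGain_le hD hN hC hAC)
  have huncovered := h.mean_uncovered_le hD
  simp only [sum_cacheGain, mean_add, mean_sub, mean_const_mul, mean_const] at huncovered ⊢
  have hsize (k : Fin 2) : mean S.placement (fun c => ((S.caches c k).card : ℝ)) ≤ B * (M + ε) :=
    h.mean_card_stored_le k
  have hN' : (0 : ℝ) ≤ N - 1 := sub_nonneg.2 (mod_cast hN)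
  exact sub_le_sub (mul_le_mul_of_nonneg_left (by linarith [hsize 0, hsize 1]) hA)
    (mul_le_mul_of_nonneg_left (mul_le_mul_of_nonneg_left
      (by linarith [hsize 0, hsize 1]) hN') hC)

end TwoUsers

end Scheme

lemma le_of_achievable {N : ℕ} {demandLaw : PMF (Fin 2 → Fin N)} (hD : ∀ d, demandLaw d ≠ 0)
    (hN : 1 ≤ N) {M R A C : ℝ} (hA : 0 ≤ A) (hC : 0 ≤ C)
    (hAC : ∀ t : ℕ, t < N → A - C * t ≤ 1 / ((t : ℝ) + 1)) (h : Achievable demandLaw M R) :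
    A * (2 * N - 2 * M) - C * ((N - 1) * (2 * M - N)) ≤ R := by
  obtain ⟨ε, -, hε, hworks⟩ := h
  set L := conditioningCost demandLaw
  have hlim : Tendsto (fun B => R + (1 + 2 * A + C * ((N - 1) * (2 + L))
      + (1 + 3 * C * N) * (2 * L)) * ε B) atTop (𝓝 R) := by
    simpa using (hε.const_mul _).const_add R
  refine ge_of_tendsto hlim ?_
  filter_upwards [hworks, eventually_gt_atTop 0] with B ⟨S, hS⟩ hB
  have hload := hS.le_load hD hN hA hC hAC
  refine le_of_mul_le_mul_left ?_ (Nat.cast_pos.2 hB : (0 : ℝ) < B)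
  linarith

lemma le_optimalLoad {N : ℕ} {demandLaw : PMF (Fin 2 → Fin N)} (hD : ∀ d, demandLaw d ≠ 0)
    (hN : 1 ≤ N) (M : ℝ) {A C : ℝ} (hA : 0 ≤ A) (hC : 0 ≤ C)
    (hAC : ∀ t : ℕ, t < N → A - C * t ≤ 1 / ((t : ℝ) + 1)) :
    ((A * (2 * N - 2 * M) - C * ((N - 1) * (2 * M - N)) : ℝ) : EReal)
      ≤ optimalLoad demandLaw M :=
  le_iInf₂ fun _ hR => EReal.coe_le_coe_iff.2 (le_of_achievable hD hN hA hC hAC hR)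

section LinearMinorants

lemma two_mul_add_two_sub_div_le_one_div (h t : ℕ) :
    (2 * h + 2 - t) / (((h : ℝ) + 1) * (h + 2)) ≤ 1 / ((t : ℝ) + 1) := by
  have hint : (0 : ℤ) ≤ (t - h) * (t - h - 1) := by
    rcases le_or_gt (t : ℤ) h with hle | hlt
    · exact mul_nonneg_of_nonpos_of_nonpos (by linarith) (by linarith)
    · exact mul_nonneg (by linarith) (by linarith)
  have hreal : (0 : ℝ) ≤ (t - h) * (t - h - 1) := by exact_mod_cast hint
  rw [div_le_div_iff₀ (by positivity) (by positivity)]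
  linarith

lemma one_div_mul_one_add_le_one_div {N t : ℕ} (ht : t < N) {v : ℝ}
    (hv : t + 1 < N → v ≤ 1 / ((t : ℝ) + 1)) :
    1 / N * (1 + (N - 1 - t) * v) ≤ 1 / ((t : ℝ) + 1) := by
  have hN : (0 : ℝ) < N := Nat.cast_pos.2 (by omega)
  have hstep : (N - 1 - t) * v ≤ (N - 1 - t) * (1 / ((t : ℝ) + 1)) := by
    rcases Nat.lt_or_ge (t + 1) N with hlt | hge
    · have hcast : (t : ℝ) + 1 < N := mod_cast hlt
      exact mul_le_mul_of_nonneg_left (hv hlt) (by linarith)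
    · have hlast : (N : ℝ) = t + 1 := mod_cast (show N = t + 1 by omega)
      simp only [hlast, add_sub_cancel_right, sub_self, zero_mul, le_refl]
  calc 1 / N * (1 + (N - 1 - t) * v)
      ≤ 1 / N * (1 + (N - 1 - t) * (1 / ((t : ℝ) + 1))) := by gcongr
    _ = 1 / ((t : ℝ) + 1) := by
        field_simp
        ring

lemma chord_slope_nonneg {N : ℕ} (hN : 2 ≤ N) (h : ℕ) :
    0 ≤ 1 / (N : ℝ) * (2 / ((h : ℝ) + 2) + (N - 2) / ((h + 1) * (h + 2))) := by
  have hN' : (0 : ℝ) ≤ N - 2 := sub_nonneg.2 (mod_cast hN)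
  exact mul_nonneg (by positivity)
    (add_nonneg (by positivity) (div_nonneg hN' (by positivity)))

lemma chord_le_one_div {N t : ℕ} (ht : t < N) (h : ℕ) :
    1 / N * (1 + 2 * (N - 1) / ((h : ℝ) + 2))
        - 1 / N * (2 / ((h : ℝ) + 2) + (N - 2) / ((h + 1) * (h + 2))) * t
      ≤ 1 / ((t : ℝ) + 1) := by
  have hsquare : (0 : ℝ) ≤ t * t - t := sub_nonneg.2 (mod_cast Nat.le_mul_self t)
  calc 1 / N * (1 + 2 * (N - 1) / ((h : ℝ) + 2))
        - 1 / N * (2 / ((h : ℝ) + 2) + (N - 2) / ((h + 1) * (h + 2))) * t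
      = 1 / N * (1 + (N - 1 - t) * ((2 * h + 2 - t) / (((h : ℝ) + 1) * (h + 2))))
        - 1 / N * ((t * t - t) / (((h : ℝ) + 1) * (h + 2))) := by
        have hN : (N : ℝ) ≠ 0 := Nat.cast_ne_zero.2 (by omega)
        field_simp
        ring
    _ ≤ 1 / N * (1 + (N - 1 - t) * ((2 * h + 2 - t) / (((h : ℝ) + 1) * (h + 2)))) :=
        sub_le_self _ (by positivity)
    _ ≤ 1 / ((t : ℝ) + 1) :=
        one_div_mul_one_add_le_one_div ht fun _ => two_mul_add_two_sub_div_le_one_div h t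

lemma last_chord_le_one_div {N t : ℕ} (hN : 2 ≤ N) (ht : t < N) :
    2 / N - 1 / ((N : ℝ) * (N - 1)) * t ≤ 1 / ((t : ℝ) + 1) := by
  have hN' : (2 : ℝ) ≤ N := mod_cast hN
  have hpred : (0 : ℝ) < N - 1 := by linarith
  calc 2 / N - 1 / ((N : ℝ) * (N - 1)) * t
      = 1 / N * (1 + (N - 1 - t) * (1 / ((N : ℝ) - 1))) := by
        field_simp
        ring
    _ ≤ 1 / ((t : ℝ) + 1) := one_div_mul_one_add_le_one_div ht fun hlt => by
        have hcast : (t : ℝ) + 1 + 1 ≤ N := mod_cast hlt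
        exact one_div_le_one_div_of_le (by positivity) (by linarith)

lemma const_le_one_div {N t : ℕ} (ht : t < N) : 1 / (N : ℝ) - 0 * t ≤ 1 / ((t : ℝ) + 1) := by
  rw [zero_mul, sub_zero]
  exact one_div_le_one_div_of_le (by positivity) (mod_cast ht)

end LinearMinorants

end D2DCaching

theorem theorem3_general (N : ℕ) (hN : 2 ≤ N) (y : ℝ) (demandLaw : PMF (Fin 2 → Fin N))
    (hD : ∀ d, demandLaw d ≠ 0) :
    (∀ h : ℕ,
      (((N : ℝ) - 2 * y - (4 * y + ((N : ℝ) - 1) * h) / ((h : ℝ) + 2)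
        + ((h : ℝ) ^ 2 * ((N : ℝ) - 1) - (N : ℝ) * ((N : ℝ) - 3) + (h : ℝ) * ((N : ℝ) + 1))
          / (((h : ℝ) + 1) * ((h : ℝ) + 2)) * (2 * y / (N : ℝ)) : ℝ) : EReal)
        ≤ D2DCaching.optimalLoad demandLaw ((N : ℝ) / 2 + y)) ∧
    ((2 * (1 - 3 * y / (N : ℝ)) : ℝ) : EReal)
      ≤ D2DCaching.optimalLoad demandLaw ((N : ℝ) / 2 + y) ∧
    ((2 * (1 / 2 - y / (N : ℝ)) : ℝ) : EReal)
      ≤ D2DCaching.optimalLoad demandLaw ((N : ℝ) / 2 + y) := by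
  have hN' : (2 : ℝ) ≤ N := mod_cast hN
  have hsub_one : (0 : ℝ) < N - 1 := by linarith
  have hbound {A C b : ℝ} (hA : 0 ≤ A) (hC : 0 ≤ C)
      (hAC : ∀ t : ℕ, t < N → A - C * t ≤ 1 / ((t : ℝ) + 1))
      (hb : b = A * (2 * N - 2 * (N / 2 + y)) - C * ((N - 1) * (2 * (N / 2 + y) - N))) :
      (b : EReal) ≤ D2DCaching.optimalLoad demandLaw ((N : ℝ) / 2 + y) :=
    hb ▸ D2DCaching.le_optimalLoad hD (by omega) _ hA hC hAC
  exact ⟨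
    fun h => hbound (by positivity) (D2DCaching.chord_slope_nonneg hN h)
      (fun t ht => D2DCaching.chord_le_one_div ht h) (by field_simp; ring),
    hbound (by positivity) (by positivity)
      (fun t => D2DCaching.last_chord_le_one_div hN) (by field_simp; ring),
    hbound (by positivity) le_rfl
      (fun t => D2DCaching.const_le_one_div) (by field_simp; ring)⟩

theorem theorem3 (N : ℕ) (hN : 2 ≤ N) (y : ℝ) (hy : y ∈ Set.Icc (0 : ℝ) ((N : ℝ) / 2))
    (demandLaw : PMF (Fin 2 → Fin N)) (hD : ∀ d, demandLaw d ≠ 0) :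
    (∀ h : ℕ, h + 3 ≤ N →
      (((N : ℝ) - 2 * y - (4 * y + ((N : ℝ) - 1) * h) / ((h : ℝ) + 2)
        + ((h : ℝ) ^ 2 * ((N : ℝ) - 1) - (N : ℝ) * ((N : ℝ) - 3) + (h : ℝ) * ((N : ℝ) + 1))
          / (((h : ℝ) + 1) * ((h : ℝ) + 2)) * (2 * y / (N : ℝ)) : ℝ) : EReal)
        ≤ D2DCaching.optimalLoad demandLaw ((N : ℝ) / 2 + y)) ∧
    ((2 * (1 - 3 * y / (N : ℝ)) : ℝ) : EReal)
      ≤ D2DCaching.optimalLoad demandLaw ((N : ℝ) / 2 + y) ∧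
    ((2 * (1 / 2 - y / (N : ℝ)) : ℝ) : EReal)
      ≤ D2DCaching.optimalLoad demandLaw ((N : ℝ) / 2 + y) := by
  have hbounds := theorem3_general N hN y demandLaw hD
  exact ⟨fun h _ => hbounds.1 h, hbounds.2⟩
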